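/- Let $n\in\mathbb N$, $T>0$ and let $\mathcal S^{n-1}$ be the unit sphere of $\mathbb R^n$. Assume that $\sigma:\mathbb R^n\to\mathbb R$ is convex and $\sigma\in C^2(\mathbb R^n\setminus\{0\})$ (positive one-homogeneity of $\sigma$ is not assumed); that $g\in C(\mathcal S^{n-1}\times\mathbb R)$ is non-decreasing in the second variable and Lipschitz in the second variable with a constant $L_g$ uniform in the first variable; and that $f\in C(\mathbb R^n\times[0,T])$ is Lipschitz in space with a constant $L_f$ uniform in time. Let $u\in C(\mathbb R^n\times[0,T])$ be a viscosity solution of $$u_t+|\nabla u|\,g\Big(\frac{\nabla u}{|\nabla u|},\,-\operatorname{div}\big(\nabla\sigma(\nabla u)\big)+f(x,t)\Big)=0\quad\text{in }\mathbb R^n\times(0,T),$$ that is: with $H(x,t,p,X)=|p|\,g\big(p/|p|,-\operatorname{tr}(\nabla^2\sigma(p)X)+f(x,t)\big)$ for $p\ne0$ and $X$ a symmetric matrix, and with $H_*$, $H^*$ its lower and upper semicontinuous envelopes (also defined at $p=0$, values $\pm\infty$ allowed), one has $\tau+H_*(x,t,p,X)\le0$ for every $(\tau,p,X)$ in the parabolic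 superjet of $u$ at $(x,t)$ and $\tau+H^*(x,t,p,X)\ge0$ for every $(\tau,p,X)$ in the parabolic subjet of $u$ at $(x,t)$, for all $(x,t)\in\mathbb R^n\times(0,T)$. Here the parabolic superjet at $(x,t)$ is the set of $(\tau,p,X)\in\mathbb R\times\mathbb R^n\times\mathrm{Sym}(n)$ with $u(y,s)\le u(x,t)+\tau(s-t)+\langle p,y-x\rangle+\tfrac12\langle X(y-x),y-x\rangle+o(|y-x|^2+|s-t|)$ as $(y,s)\to(x,t)$, and the subjet is defined with the reversed inequality. Assume that there is a ball $B\subset\mathbb R^n$ such that $u$ is constant on $(\mathbb R^n\setminus B)\times[0,T]$. If the initial data $u_0=u(\cdot,0)$ is Lipschitz, then $$|u(x,t)-u(y,t)|\le L e^{Mt}|x-y|\qquad\text{for all }x,y\in\mathbb R^n,\ t\in[0,T],$$ with $M=L_gL_f$ and $L=\operatorname{Lip}(u_0)$, the smallest Lipschitz constant of $u_0$. -/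

import Mathlib

open Set Filter Topology Metric
open scoped NNReal

noncomputable section

/-- Euclidean space `ℝⁿ`. -/
abbrev Eucl (n : ℕ) : Type := EuclideanSpace ℝ (Fin n)

/-- Linear endomorphisms of `ℝⁿ`; the symmetric ones play the role of Hessians. -/
abbrev Endo (n : ℕ) : Type := Eucl n →L[ℝ] Eucl n

/-- The Hessian `∇²σ(p)`, as the derivative of the gradient field `∇σ` at `p`. -/
def hess {n : ℕ} (σ : Eucl n → ℝ) (p : Eucl n) : Endo n :=
  fderiv ℝ (gradient σ) p

/-- The trace of an endomorphism of `ℝⁿ`. -/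
def endoTrace {n : ℕ} (A : Endo n) : ℝ :=
  LinearMap.trace ℝ (Eucl n) (A : Eucl n →ₗ[ℝ] Eucl n)

/-- The spatial operator of the level set equation,
`H(x, t, p, X) = |p| g(p / |p|, -tr(∇²σ(p) X) + f(x, t))`, meaningful for `p ≠ 0`.
With `p = ∇u` and `X = ∇²u` one has `tr(∇²σ(p) X) = div(∇σ(∇u))`. -/
def levelSetOp {n : ℕ} (σ : Eucl n → ℝ) (g : Eucl n → ℝ → ℝ) (f : Eucl n → ℝ → ℝ)
    (q : Eucl n × ℝ × Eucl n × Endo n) : ℝ :=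
  ‖q.2.2.1‖ * g (‖q.2.2.1‖⁻¹ • q.2.2.1)
    (-endoTrace ((hess σ q.2.2.1).comp q.2.2.2) + f q.1 q.2.1)

/-- The set of `(x, t, p, X)` with `p ≠ 0` and `X` symmetric, where the operator is defined. -/
def regularSet (n : ℕ) : Set (Eucl n × ℝ × Eucl n × Endo n) :=
  {q | q.2.2.1 ≠ 0 ∧ (q.2.2.2 : Eucl n →ₗ[ℝ] Eucl n).IsSymmetric}

/-- Lower semicontinuous envelope at `z` of a function defined on `W`, with values in `[-∞, ∞]`. -/
def lowerEnv {α : Type*} [TopologicalSpace α] (W : Set α) (H : α → ℝ) (z : α) : EReal :=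
  liminf (fun w => (H w : EReal)) (𝓝[W] z)

/-- Upper semicontinuous envelope at `z` of a function defined on `W`, with values in `[-∞, ∞]`. -/
def upperEnv {α : Type*} [TopologicalSpace α] (W : Set α) (H : α → ℝ) (z : α) : EReal :=
  limsup (fun w => (H w : EReal)) (𝓝[W] z)

/-- `(τ, p, X)` belongs to the parabolic superjet of `u` at `(x, t)`: `X` is symmetric and
`u(y, s) ≤ u(x, t) + τ (s - t) + ⟨p, y - x⟩ + ⟨X (y - x), y - x⟩ / 2 + o(|y - x|² + |s - t|)`
as `(y, s) → (x, t)`. -/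
def IsSuperjet {n : ℕ} (u : Eucl n → ℝ → ℝ) (x : Eucl n) (t : ℝ)
    (τ : ℝ) (p : Eucl n) (X : Endo n) : Prop :=
  (X : Eucl n →ₗ[ℝ] Eucl n).IsSymmetric ∧
  ∀ ε : ℝ, 0 < ε → ∀ᶠ z : Eucl n × ℝ in 𝓝 (x, t),
    u z.1 z.2 ≤ u x t + τ * (z.2 - t) + inner ℝ p (z.1 - x)
      + inner ℝ (X (z.1 - x)) (z.1 - x) / 2 + ε * (‖z.1 - x‖ ^ 2 + |z.2 - t|)

/-- `(τ, p, X)` belongs to the parabolic subjet of `u` at `(x, t)`: `X` is symmetric and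
`u(y, s) ≥ u(x, t) + τ (s - t) + ⟨p, y - x⟩ + ⟨X (y - x), y - x⟩ / 2 + o(|y - x|² + |s - t|)`
as `(y, s) → (x, t)`. -/
def IsSubjet {n : ℕ} (u : Eucl n → ℝ → ℝ) (x : Eucl n) (t : ℝ)
    (τ : ℝ) (p : Eucl n) (X : Endo n) : Prop :=
  (X : Eucl n →ₗ[ℝ] Eucl n).IsSymmetric ∧
  ∀ ε : ℝ, 0 < ε → ∀ᶠ z : Eucl n × ℝ in 𝓝 (x, t),
    u x t + τ * (z.2 - t) + inner ℝ p (z.1 - x)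
      + inner ℝ (X (z.1 - x)) (z.1 - x) / 2 - ε * (‖z.1 - x‖ ^ 2 + |z.2 - t|) ≤ u z.1 z.2

/-- `u` is a viscosity subsolution of
`u_t + |∇u| g(∇u / |∇u|, -div(∇σ(∇u)) + f) = 0` in `ℝⁿ × (0, T)`. Semicontinuity of `u` is not
part of this predicate. At slopes `p ≠ 0` the envelope of a continuous operator is the operator. -/
def IsViscSub {n : ℕ} (σ : Eucl n → ℝ) (g : Eucl n → ℝ → ℝ) (f : Eucl n → ℝ → ℝ) (T : ℝ)
    (u : Eucl n → ℝ → ℝ) : Prop :=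
  ∀ x : Eucl n, ∀ t ∈ Ioo (0 : ℝ) T, ∀ (τ : ℝ) (p : Eucl n) (X : Endo n),
    IsSuperjet u x t τ p X →
      (τ : EReal) + lowerEnv (regularSet n) (levelSetOp σ g f) (x, t, p, X) ≤ 0

/-- `u` is a viscosity supersolution of the same equation in `ℝⁿ × (0, T)`. -/
def IsViscSuper {n : ℕ} (σ : Eucl n → ℝ) (g : Eucl n → ℝ → ℝ) (f : Eucl n → ℝ → ℝ) (T : ℝ)
    (u : Eucl n → ℝ → ℝ) : Prop :=
  ∀ x : Eucl n, ∀ t ∈ Ioo (0 : ℝ) T, ∀ (τ : ℝ) (p : Eucl n) (X : Endo n),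
    IsSubjet u x t τ p X →
      0 ≤ (τ : EReal) + upperEnv (regularSet n) (levelSetOp σ g f) (x, t, p, X)

/-- A continuous viscosity solution `u ∈ C(ℝⁿ × [0, T])` of the level set equation in
`ℝⁿ × (0, T)`. -/
structure IsViscSol {n : ℕ} (σ : Eucl n → ℝ) (g : Eucl n → ℝ → ℝ) (f : Eucl n → ℝ → ℝ) (T : ℝ)
    (u : Eucl n → ℝ → ℝ) : Prop where
  cont : ContinuousOn (fun z : Eucl n × ℝ => u z.1 z.2) (univ ×ˢ Icc (0 : ℝ) T)
  sub : IsViscSub σ g f T u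
  super : IsViscSuper σ g f T u

/-- The (smallest) Lipschitz constant `Lip(v)` of a Lipschitz function `v`. -/
def lipConst {n : ℕ} (v : Eucl n → ℝ) : ℝ≥0 :=
  sInf {K : ℝ≥0 | LipschitzWith K v}

end

/-!
The proof doubles the variables. If the asserted estimate failed, then for a suitable barrier
`φ(x, t, y, s) = L e^{Mt} √(|x - y|² + κ²) + S e^{N(t - T')} + S e^{N(s - T')} + R (t - s)²`
the function `u(x, t) - u(y, s) - φ` would have a large value on a compact cylinder, while all its
large values are taken in the interior and away from `x = y`: the exponential terms exclude
`t, s = T'`, the Lipschitz bound of `u₀` excludes `t, s = 0`, and `u` being constant far away excludes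
the lateral boundary (`penalized_localization`). At an interior maximum the slopes of `u` at the two
points agree and do not vanish, so the operator is continuous there and its envelopes play no role.
The Hessians satisfy `X ≤ Y` because `φ` is invariant under a common spatial translation of both
points. Subtracting the two viscosity inequalities leaves, on one side,
`M L e^{Mt} √(|x - y|² + κ²)` plus a positive constant coming from the exponential barriers, and on
the other at most `|p| L_g L_f |x - y|` plus small errors, with `|p| ≤ L e^{Mt}`; as `M = L_g L_f`,
this is absurd (`penalized_difference_lt`).

The Hessians at the maximum are provided by a version of the Jensen and Alexandrov theorems,
`exists_contact_second_order`. For a semiconvex function `Ψ` and a smooth `φ` such that `Ψ - φ` has an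
interior maximum, every small linear perturbation has an interior maximum as well. Adding a
paraboloid makes `Ψ` convex, say `ψ`; the map `x + q ↦ x`, for `q` a subgradient of `ψ` at `x`, is
nonexpansive (Minty), and the perturbation is a Lipschitz function of `x + q` at the contact points.
As the perturbations fill a ball, the points `x + q` have positive measure, so by Rademacher's
theorem the nonexpansive map is differentiable at one of them. At a contact point `ψ` lies below
a paraboloid, which bounds the difference quotients of the subgradients, so that the derivative is
invertible; hence the subgradients are differentiable at `x`, and integration along segments gives
a second order expansion of `Ψ`.

It is applied to the sup-convolutions of `u` and `-u` on the cylinder, with time treated as one more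
Euclidean variable. Expansions of a sup-convolution are inherited, as one-sided expansions, by
the original function at the point where the supremum is attained
(`IsSupConv.expansion_le`), and expansions in all variables give parabolic jets
(`isSuperjet_of_expansion`).
-/

noncomputable section

open scoped RealInnerProductSpace

/-! ### Second order expansions of convex functions from their subgradients -/

/-- A Riemann sum estimate: increments at most `c s ds`, up to an error of order `ds²`, add up to at
most `c / 2` over the unit interval. -/
lemma sub_le_half_of_forall_step {θ : ℝ → ℝ} {c C : ℝ}
    (h : ∀ s s' : ℝ, 0 ≤ s → s ≤ s' → s' ≤ 1 → θ s' - θ s ≤ c * s * (s' - s) + C * (s' - s) ^ 2) :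
    θ 1 - θ 0 ≤ c / 2 := by
  have key : ∀ N : ℕ, 0 < N → θ 1 - θ 0 ≤ c / 2 + (C - c / 2) / N := by
    intro N hN
    have hN' : (0 : ℝ) < N := by exact_mod_cast hN
    have ind : ∀ i : ℕ, i ≤ N → θ (i / N) - θ 0 ≤ c * (i * (i - 1)) / (2 * N ^ 2) + C * i / N ^ 2 := by
      intro i
      induction i with
      | zero => intro _; simp
      | succ i ih =>
        intro hi
        have h1 := ih (by omega)
        have h2 := h (i / N) ((i + 1 : ℕ) / N) (by positivity) (by gcongr; simp)
          (by rw [div_le_one hN']; exact_mod_cast hi)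
        have h3 : (((i + 1 : ℕ) : ℝ) / N - i / N) = 1 / N := by push_cast; field_simp; ring
        rw [h3] at h2
        have h4 : c * (((i + 1 : ℕ) : ℝ) * (((i + 1 : ℕ) : ℝ) - 1)) / (2 * N ^ 2)
            + C * ((i + 1 : ℕ) : ℝ) / N ^ 2
            = (c * (i * (i - 1)) / (2 * N ^ 2) + C * i / N ^ 2)
              + (c * (i / N) * (1 / N) + C * (1 / N) ^ 2) := by
          push_cast; field_simp; ring
        rw [h4]; linarith
    have h5 := ind N le_rfl
    rw [div_self hN'.ne'] at h5
    refine h5.trans (le_of_eq ?_)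
    field_simp; ring
  have lim : Tendsto (fun N : ℕ => c / 2 + (C - c / 2) / (N : ℝ)) atTop (𝓝 (c / 2 + 0)) :=
    tendsto_const_nhds.add (tendsto_const_div_atTop_nhds_zero_nat _)
  rw [add_zero] at lim
  exact ge_of_tendsto lim (eventually_atTop.2 ⟨1, fun N hN => key N hN⟩)

section
variable {F : Type*} [NormedAddCommGroup F] [InnerProductSpace ℝ F]

/-- If a selection `q` of subgradients of `ψ` near `x` is differentiable at `x` with derivative `A`,
then `ψ` has a second order expansion at `x` with quadratic form `⟪A h, h⟫`. The derivative `A`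
need not be symmetric, nor `q` continuous away from `x`. -/
lemma second_order_expansion_of_subgradient {ψ : F → ℝ} {q : F → F} {K : Set F} {x : F}
    {A : F →L[ℝ] F} (hK : K ∈ 𝓝 x) (hq : ∀ a ∈ K, ∀ b ∈ K, ψ a + ⟪q a, b - a⟫ ≤ ψ b)
    (hA : HasFDerivAt q A x) {ε : ℝ} (hε : 0 < ε) :
    ∀ᶠ h in 𝓝 (0 : F), |ψ (x + h) - ψ x - ⟪q x, h⟫ - ⟪A h, h⟫ / 2| ≤ ε * ‖h‖ ^ 2 := by
  have h1 : ∀ᶠ h in 𝓝 (0 : F), ‖q (x + h) - q x - A h‖ ≤ ε * ‖h‖ :=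
    (hasFDerivAt_iff_isLittleO_nhds_zero.1 hA).def hε
  have h2 : ∀ᶠ h in 𝓝 (0 : F), x + h ∈ K := by
    have : Tendsto (fun h : F => x + h) (𝓝 0) (𝓝 x) := by
      simpa using (tendsto_const_nhds (x := x)).add (tendsto_id (x := 𝓝 (0 : F)))
    exact this hK
  obtain ⟨r, hr, hball⟩ := Metric.eventually_nhds_iff_ball.1 (h1.and h2)
  filter_upwards [ball_mem_nhds (0 : F) hr] with h hh
  have hs : ∀ s : ℝ, 0 ≤ s → s ≤ 1 → s • h ∈ ball (0 : F) r := by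
    intro s hs0 hs1
    rw [mem_ball_zero_iff] at hh ⊢
    rw [norm_smul, Real.norm_of_nonneg hs0]
    nlinarith [norm_nonneg h]
  -- slopes along the segment from `x` to `x + h`
  have hg : ∀ s : ℝ, 0 ≤ s → s ≤ 1 →
      |⟪q (x + s • h), h⟫ - ⟪q x, h⟫ - s * ⟪A h, h⟫| ≤ ε * ‖h‖ ^ 2 * s := by
    intro s hs0 hs1
    have e1 := (hball _ (hs s hs0 hs1)).1
    have e2 : ⟪q (x + s • h), h⟫ - ⟪q x, h⟫ - s * ⟪A h, h⟫
        = ⟪q (x + s • h) - q x - A (s • h), h⟫ := by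
      rw [map_smul, inner_sub_left, inner_sub_left, real_inner_smul_left]
    rw [e2]
    refine (abs_real_inner_le_norm _ _).trans ?_
    rw [norm_smul, Real.norm_of_nonneg hs0] at e1
    nlinarith [norm_nonneg h]
  have hst : ∀ s s' : ℝ, 0 ≤ s → s ≤ 1 → 0 ≤ s' → s' ≤ 1 →
      ψ (x + s • h) + (s' - s) * ⟪q (x + s • h), h⟫ ≤ ψ (x + s' • h) := by
    intro s s' hs0 hs1 hs0' hs1'
    have := hq _ (hball _ (hs s hs0 hs1)).2 _ (hball _ (hs s' hs0' hs1')).2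
    have e : x + s' • h - (x + s • h) = (s' - s) • h := by rw [sub_smul]; abel
    rwa [e, real_inner_smul_right] at this
  set a := ⟪A h, h⟫
  set b := ⟪q x, h⟫
  set e := ε * ‖h‖ ^ 2 with he
  have he0 : 0 ≤ e := by positivity
  have up := sub_le_half_of_forall_step (θ := fun s => ψ (x + s • h) - s * b) (c := a + e)
    (C := |a + e|) (by
      intro s s' h0 h01 h1
      have k1 := hst s' s (h0.trans h01) h1 h0 (h01.trans h1)
      have k2 := (abs_le.1 (hg s' (h0.trans h01) h1)).2
      have k3 : (s' - s) * ⟪q (x + s' • h), h⟫ ≤ (s' - s) * (b + s' * a + e * s') :=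
        mul_le_mul_of_nonneg_left (by linarith) (by linarith)
      have k4 : (a + e) * (s' - s) ^ 2 ≤ |a + e| * (s' - s) ^ 2 :=
        mul_le_mul_of_nonneg_right (le_abs_self _) (sq_nonneg _)
      nlinarith)
  have low := sub_le_half_of_forall_step (θ := fun s => -(ψ (x + s • h) - s * b)) (c := e - a)
    (C := 0) (by
      intro s s' h0 h01 h1
      have k1 := hst s s' h0 (h01.trans h1) (h0.trans h01) h1
      have k2 := (abs_le.1 (hg s h0 (h01.trans h1))).1
      have k3 : (s' - s) * (b + s * a - e * s) ≤ (s' - s) * ⟪q (x + s • h), h⟫ :=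
        mul_le_mul_of_nonneg_left (by linarith) (by linarith)
      nlinarith)
  simp only [one_smul, zero_smul, add_zero, one_mul, zero_mul, sub_zero] at up low
  rw [abs_le]
  constructor <;> linarith

/-- A convex function touched from above by a paraboloid of opening `Λ` at `x` has subgradients that
are Lipschitz at `x`. -/
lemma norm_subgradient_sub_le {ψ : F → ℝ} {q : F → F} {K : Set F} {x : F} {Λ : ℝ} (hΛ : 0 ≤ Λ)
    (hK : K ∈ 𝓝 x) (hq : ∀ a ∈ K, ∀ b ∈ K, ψ a + ⟪q a, b - a⟫ ≤ ψ b)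
    (hup : ∀ b ∈ K, ψ b ≤ ψ x + ⟪q x, b - x⟫ + Λ / 2 * ‖b - x‖ ^ 2) :
    ∀ᶠ a in 𝓝 x, ‖q a - q x‖ ≤ 2 * Λ * ‖a - x‖ := by
  obtain ⟨r, hr, hball⟩ := Metric.nhds_basis_ball.mem_iff.1 hK
  filter_upwards [ball_mem_nhds x (half_pos hr)] with a ha
  rw [mem_ball, dist_eq_norm] at ha
  rcases eq_or_ne (q a - q x) 0 with h0 | h0
  · rw [h0, norm_zero]; positivity
  rcases eq_or_ne a x with rfl | hax
  · simp
  have hn : 0 < ‖q a - q x‖ := norm_pos_iff.2 h0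
  have hr' : 0 < ‖a - x‖ := norm_pos_iff.2 (sub_ne_zero.2 hax)
  set v : F := (‖a - x‖ / ‖q a - q x‖) • (q a - q x) with hv
  have hvn : ‖v‖ = ‖a - x‖ := by
    rw [hv, norm_smul, Real.norm_of_nonneg (by positivity)]; field_simp
  have hb : ‖a + v - x‖ ≤ 2 * ‖a - x‖ := by
    calc ‖a + v - x‖ = ‖(a - x) + v‖ := by congr 1; abel
      _ ≤ ‖a - x‖ + ‖v‖ := norm_add_le _ _
      _ = _ := by rw [hvn]; ring
  have haK : a ∈ K := hball (by rw [mem_ball, dist_eq_norm]; linarith)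
  have hbK : a + v ∈ K := hball (by rw [mem_ball, dist_eq_norm]; linarith)
  have hxK : x ∈ K := mem_of_mem_nhds hK
  have e1 := hq a haK _ hbK
  have e2 := hq x hxK a haK
  have e3 := hup _ hbK
  have e4 : ⟪q x, a + v - x⟫ = ⟪q x, a - x⟫ + ⟪q x, v⟫ := by
    rw [← inner_add_right]; congr 1; abel
  have e5 : ⟪q a - q x, v⟫ = ‖a - x‖ * ‖q a - q x‖ := by
    rw [hv, real_inner_smul_right, real_inner_self_eq_norm_sq]; field_simp
  rw [inner_sub_left] at e5
  have e6 : ‖a + v - x‖ ^ 2 ≤ (2 * ‖a - x‖) ^ 2 := by gcongr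
  rw [add_sub_cancel_left] at e1
  have e7 : ‖a - x‖ * ‖q a - q x‖ ≤ Λ / 2 * (2 * ‖a - x‖) ^ 2 := by
    have := mul_le_mul_of_nonneg_left e6 (div_nonneg hΛ zero_le_two)
    linarith
  have e8 : ‖a - x‖ * ‖q a - q x‖ ≤ ‖a - x‖ * (2 * Λ * ‖a - x‖) := by linarith
  exact le_of_mul_le_mul_left e8 hr'

end

/-- A map `Y` that is Lipschitz at `x` is differentiable at `x` as soon as it has a left inverse which is
differentiable at `Y x`. No injectivity of the derivative `D` of the left inverse is assumed: the
increments of `Y` show that `D` has dense range, hence is bijective in finite dimension. -/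
lemma exists_hasFDerivAt_of_leftInverse {F : Type*} [NormedAddCommGroup F] [NormedSpace ℝ F]
    [FiniteDimensional ℝ F] {J Y : F → F} {x : F} {C : ℝ} (hC : 0 ≤ C)
    (hJ : DifferentiableAt ℝ J (Y x)) (hJY : ∀ᶠ a in 𝓝 x, J (Y a) = a)
    (hY : ∀ᶠ a in 𝓝 x, ‖Y a - Y x‖ ≤ C * ‖a - x‖) :
    ∃ B : F →L[ℝ] F, ‖B‖ ≤ C ∧ HasFDerivAt Y B x := by
  have hcont : ContinuousAt Y x := by
    rw [ContinuousAt, tendsto_iff_norm_sub_tendsto_zero]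
    have h1 : Tendsto (fun a => C * ‖a - x‖) (𝓝 x) (𝓝 (C * ‖x - x‖)) := by
      have : Continuous fun a : F => C * ‖a - x‖ := by fun_prop
      exact this.tendsto x
    rw [sub_self, norm_zero, mul_zero] at h1
    exact squeeze_zero' (Eventually.of_forall fun _ => norm_nonneg _) hY h1
  set D := fderiv ℝ J (Y x)
  have hD : HasFDerivAt J D (Y x) := hJ.hasFDerivAt
  have hsurj : Function.Surjective D := by
    intro h
    have hcl : IsClosed (LinearMap.range (D : F →ₗ[ℝ] F) : Set F) :=
      Submodule.closed_of_finiteDimensional _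
    suffices h ∈ (LinearMap.range (D : F →ₗ[ℝ] F) : Set F) by
      obtain ⟨k, hk⟩ := this
      exact ⟨k, hk⟩
    rw [← hcl.closure_eq, Metric.mem_closure_iff]
    intro ε hε
    set ε' := ε / (C * ‖h‖ + 1) with hε'
    have hden : 0 < C * ‖h‖ + 1 := by positivity
    have h1 : ∀ᶠ y in 𝓝 (Y x), ‖J y - J (Y x) - D (y - Y x)‖ ≤ ε' * ‖y - Y x‖ :=
      hD.isLittleO.def (by positivity)
    have h2 := (hcont.eventually h1).and (hJY.and hY)
    have h3 : Tendsto (fun t : ℝ => x + t • h) (𝓝[>] 0) (𝓝 x) := by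
      have : Continuous fun t : ℝ => x + t • h := by fun_prop
      have h4 := this.tendsto 0
      rw [zero_smul, add_zero] at h4
      exact h4.mono_left nhdsWithin_le_nhds
    obtain ⟨t, ⟨ht1, ht2, ht3⟩, ht0⟩ := ((h3.eventually h2).and self_mem_nhdsWithin).exists
    have ht0 : 0 < t := ht0
    refine ⟨D (t⁻¹ • (Y (x + t • h) - Y x)), ⟨_, rfl⟩, ?_⟩
    rw [ht2, hJY.self_of_nhds, add_sub_cancel_left] at ht1
    rw [add_sub_cancel_left, norm_smul, Real.norm_of_nonneg ht0.le] at ht3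
    have h5 : h - D (t⁻¹ • (Y (x + t • h) - Y x))
        = t⁻¹ • (t • h - D (Y (x + t • h) - Y x)) := by
      rw [map_smul, smul_sub, smul_smul, inv_mul_cancel₀ ht0.ne', one_smul]
    rw [dist_eq_norm, h5, norm_smul, norm_inv, Real.norm_of_nonneg ht0.le]
    have h6 : ‖t • h - D (Y (x + t • h) - Y x)‖ ≤ ε' * (C * (t * ‖h‖)) :=
      ht1.trans (mul_le_mul_of_nonneg_left ht3 (by positivity))
    calc t⁻¹ * ‖t • h - D (Y (x + t • h) - Y x)‖ ≤ t⁻¹ * (ε' * (C * (t * ‖h‖))) := by gcongr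
      _ = ε' * (C * ‖h‖) := by field_simp
      _ < ε' * (C * ‖h‖ + 1) := by
          have : 0 < ε' := by positivity
          nlinarith
      _ = ε := by rw [hε']; field_simp
  have hinj : Function.Injective D :=
    (LinearMap.injective_iff_surjective (f := (D : F →ₗ[ℝ] F))).2 hsurj
  let De : F ≃L[ℝ] F := (LinearEquiv.ofBijective (D : F →ₗ[ℝ] F) ⟨hinj, hsurj⟩).toContinuousLinearEquiv
  have hDe : (De : F →L[ℝ] F) = D := by ext v; rfl
  have hder : HasFDerivAt Y (De.symm : F →L[ℝ] F) x :=
    HasFDerivAt.of_local_left_inverse hcont (by rw [hDe]; exact hD) hJY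
  exact ⟨_, hder.le_of_lip' hC hY, hder⟩

section
open MeasureTheory
variable {F : Type*} [NormedAddCommGroup F] [InnerProductSpace ℝ F]

lemma eq_zero_of_inner_le_sq {v : F} {Λ : ℝ}
    (h : ∀ᶠ b in 𝓝 (0 : F), ⟪v, b⟫ ≤ Λ * ‖b‖ ^ 2) : v = 0 := by
  have h1 : Tendsto (fun t : ℝ => t • v) (𝓝[>] 0) (𝓝 0) := by
    have : Continuous fun t : ℝ => t • v := by fun_prop
    have h4 := this.tendsto 0
    rw [zero_smul] at h4
    exact h4.mono_left nhdsWithin_le_nhds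
  have h2 : ∀ᶠ t : ℝ in 𝓝[>] 0, ‖v‖ ^ 2 ≤ Λ * ‖v‖ ^ 2 * t := by
    filter_upwards [h1.eventually h, self_mem_nhdsWithin] with t ht ht0
    have ht0 : 0 < t := ht0
    rw [real_inner_smul_right, real_inner_self_eq_norm_sq, norm_smul,
      Real.norm_of_nonneg ht0.le] at ht
    have : t * ‖v‖ ^ 2 ≤ t * (Λ * ‖v‖ ^ 2 * t) := by linarith
    exact le_of_mul_le_mul_left this ht0
  have h3 : Tendsto (fun t : ℝ => Λ * ‖v‖ ^ 2 * t) (𝓝[>] 0) (𝓝 0) := by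
    have : Continuous fun t : ℝ => Λ * ‖v‖ ^ 2 * t := by fun_prop
    have h4 := this.tendsto 0
    rw [mul_zero] at h4
    exact h4.mono_left nhdsWithin_le_nhds
  have h5 : ‖v‖ ^ 2 ≤ 0 := ge_of_tendsto h3 h2
  have h6 : ‖v‖ = 0 := by nlinarith [norm_nonneg v]
  exact norm_eq_zero.1 h6

/-- A set whose image under a Lipschitz map contains a ball is not Lebesgue null, so by Rademacher's
theorem any Lipschitz function is differentiable somewhere on it. -/
lemma exists_mem_differentiableAt_of_ball_subset_image [FiniteDimensional ℝ F] {J P : F → F}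
    {Y : Set F} {C C' : ℝ≥0} (hJ : LipschitzWith C J) (hP : LipschitzOnWith C' P Y) {c : F} {r : ℝ}
    (hr : 0 < r) (hball : ball c r ⊆ P '' Y) : ∃ y ∈ Y, DifferentiableAt ℝ J y := by
  borelize F
  by_contra! hcon
  set μ : Measure F := Measure.hausdorffMeasure (Module.finrank ℝ F : ℝ)
  have h0 : μ Y = 0 := measure_mono_null hcon (hJ.ae_differentiableAt (μ := μ))
  have h1 := hP.hausdorffMeasure_image_le (d := (Module.finrank ℝ F : ℝ)) (by positivity)
  have h2 : μ (P '' Y) = 0 := by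
    refine le_antisymm (h1.trans ?_) bot_le
    change _ * μ Y ≤ _
    rw [h0, mul_zero]
  exact (measure_ball_pos μ c hr).ne' (measure_mono_null hball h2)

/-- The resolvent `x + q ↦ x` of the subdifferential of `ψ` on `K` is nonexpansive where it is defined
(Minty); it is extended to a Lipschitz map of the whole space. -/
lemma exists_lipschitz_resolvent [FiniteDimensional ℝ F] {ψ : F → ℝ} {K : Set F} :
    ∃ (J : F → F) (C : ℝ≥0), LipschitzWith C J ∧ ∀ a ∈ K, ∀ q : F,
      (∀ b ∈ K, ψ a + ⟪q, b - a⟫ ≤ ψ b) → J (a + q) = a := by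
  set S : Set F := {y | ∃ a ∈ K, ∀ b ∈ K, ψ a + ⟪y - a, b - a⟫ ≤ ψ b}
  choose! j hjK hj using fun (y : F) (hy : y ∈ S) => hy
  have mono : ∀ y a y' a', a ∈ K → a' ∈ K → (∀ b ∈ K, ψ a + ⟪y - a, b - a⟫ ≤ ψ b) →
      (∀ b ∈ K, ψ a' + ⟪y' - a', b - a'⟫ ≤ ψ b) → ‖a - a'‖ ≤ ‖y - y'‖ := by
    intro y a y' a' ha ha' h h'
    have e1 := h a' ha'
    have e2 := h' a ha
    have e3 : ⟪y - a, a' - a⟫ + ⟪y' - a', a - a'⟫ = ‖a - a'‖ ^ 2 - ⟪y - y', a - a'⟫ := by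
      have : a' - a = -(a - a') := by abel
      rw [this, inner_neg_right, ← real_inner_self_eq_norm_sq]
      simp only [inner_sub_left]
      ring
    have e4 := real_inner_le_norm (y - y') (a - a')
    rcases eq_or_ne ‖a - a'‖ 0 with h0 | h0
    · rw [h0]; positivity
    have h0 : 0 < ‖a - a'‖ := lt_of_le_of_ne (norm_nonneg _) h0.symm
    have e5 : ‖a - a'‖ * ‖a - a'‖ ≤ ‖y - y'‖ * ‖a - a'‖ := by nlinarith
    exact le_of_mul_le_mul_right e5 h0
  have hlip : LipschitzOnWith 1 j S := by
    refine LipschitzOnWith.of_dist_le_mul fun y hy y' hy' => ?_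
    rw [dist_eq_norm, dist_eq_norm, NNReal.coe_one, one_mul]
    exact mono _ _ _ _ (hjK y hy) (hjK y' hy') (hj y hy) (hj y' hy')
  obtain ⟨J, hJ, hJS⟩ := hlip.extend_finite_dimension
  refine ⟨J, _, hJ, fun a ha q hq => ?_⟩
  have hq' : ∀ b ∈ K, ψ a + ⟪a + q - a, b - a⟫ ≤ ψ b := by simpa using hq
  have hS : a + q ∈ S := ⟨a, ha, hq'⟩
  rw [← hJS hS]
  have := mono _ _ _ _ (hjK _ hS) ha (hj _ hS) hq'
  rw [sub_self, norm_zero] at this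
  exact sub_eq_zero.1 (norm_le_zero_iff.1 this)

/-- The Jensen and Alexandrov theorems combined. If `Ψ` is semiconvex, `φ` has a Lipschitz gradient
`G`, and `Ψ - φ` on the compact set `K` does not attain its maximum on the boundary, then there are
arbitrarily small `p` and interior maximum points `x` of `Ψ - φ - ⟪p, ·⟫` at which `Ψ` has a second
order expansion, with Hessians bounded independently of `p`. -/
theorem exists_contact_second_order [FiniteDimensional ℝ F] {K : Set F} (hK : IsCompact K)
    {Ψ φ : F → ℝ} {G : F → F} {lam C : ℝ≥0} (hΨc : ContinuousOn Ψ K) (hφc : ContinuousOn φ K)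
    (hΨ : ∀ a ∈ K, ∃ q, ∀ b ∈ K, Ψ a + ⟪q, b - a⟫ - lam / 2 * ‖b - a‖ ^ 2 ≤ Ψ b)
    (hG : LipschitzOnWith C G K)
    (hφ : ∀ a ∈ K, ∀ b ∈ K, φ b ≤ φ a + ⟪G a, b - a⟫ + C / 2 * ‖b - a‖ ^ 2)
    {z₀ : F} (hz₀ : z₀ ∈ K) (hmax : ∀ a ∈ K, a ∉ interior K → Ψ a - φ a < Ψ z₀ - φ z₀) :
    ∃ C' : ℝ, ∀ δ > 0, ∃ x ∈ interior K, ∃ (p : F) (A : F →L[ℝ] F), ‖p‖ ≤ δ ∧ ‖A‖ ≤ C' ∧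
      (∀ b ∈ K, Ψ b - φ b - ⟪p, b - x⟫ ≤ Ψ x - φ x) ∧
      ∀ ε > 0, ∀ᶠ h in 𝓝 (0 : F),
        |Ψ (x + h) - Ψ x - ⟪G x + p, h⟫ - ⟪A h, h⟫ / 2| ≤ ε * ‖h‖ ^ 2 := by
  -- the gap between the maximum and the values on the boundary
  obtain ⟨m, hm, hgap⟩ : ∃ m > 0, ∀ a ∈ K, a ∉ interior K → Ψ a - φ a + m ≤ Ψ z₀ - φ z₀ := by
    rcases (K \ interior K).eq_empty_or_nonempty with h | h
    · exact ⟨1, one_pos, fun a ha hai => absurd (show a ∈ K \ interior K from ⟨ha, hai⟩) (by simp [h])⟩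
    · obtain ⟨a, ha, hamax⟩ := (hK.diff isOpen_interior).exists_isMaxOn h
        ((hΨc.sub hφc).mono sdiff_subset)
      refine ⟨Ψ z₀ - φ z₀ - (Ψ a - φ a), sub_pos.2 (hmax a ha.1 ha.2), fun b hb hbi => ?_⟩
      have : Ψ b - φ b ≤ Ψ a - φ a := hamax ⟨hb, hbi⟩
      linarith
  obtain ⟨D, hD, hKD⟩ : ∃ D > 0, ∀ a ∈ K, ‖z₀ - a‖ ≤ D := by
    obtain ⟨D, hD⟩ := hK.isBounded.exists_norm_le
    refine ⟨‖z₀‖ + |D| + 1, by positivity, fun a ha => ?_⟩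
    calc ‖z₀ - a‖ ≤ ‖z₀‖ + ‖a‖ := norm_sub_le _ _
      _ ≤ _ := by linarith [hD a ha, le_abs_self D]
  -- the convex function obtained by adding a paraboloid, and a selection of its subgradients
  set ψ : F → ℝ := fun a => Ψ a + lam / 2 * ‖a‖ ^ 2 with hψ
  have hsq : ∀ a b : F, ‖b‖ ^ 2 = ‖a‖ ^ 2 + 2 * ⟪a, b - a⟫ + ‖b - a‖ ^ 2 := by
    intro a b
    have := norm_add_sq_real a (b - a)
    rwa [add_sub_cancel] at this
  have hψq : ∀ a : F, ∃ q, a ∈ K → ∀ b ∈ K, ψ a + ⟪q, b - a⟫ ≤ ψ b := by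
    intro a
    by_cases ha : a ∈ K
    · obtain ⟨q, hq⟩ := hΨ a ha
      refine ⟨q + (lam : ℝ) • a, fun _ b hb => ?_⟩
      have := hq b hb
      rw [inner_add_left, real_inner_smul_left]
      simp only [hψ]
      rw [hsq a b]
      linarith
    · exact ⟨0, fun h => absurd h ha⟩
  choose q hq using hψq
  obtain ⟨J, CJ, hJ, hJK⟩ := exists_lipschitz_resolvent (ψ := ψ) (K := K)
  set Λ : ℝ := C + lam with hΛ
  have hΛ0 : 0 ≤ Λ := by positivity
  refine ⟨(1 + 2 * Λ) + 1 + lam, fun δ hδ => ?_⟩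
  set δ' := min δ (m / (D + 1)) with hδ'
  have hδ'0 : 0 < δ' := lt_min hδ (by positivity)
  -- existence of contact points
  have hcontact : ∀ p ∈ ball (0 : F) δ', ∃ x ∈ interior K,
      ∀ b ∈ K, Ψ b - φ b - ⟪p, b - x⟫ ≤ Ψ x - φ x := by
    intro p hp
    rw [mem_ball_zero_iff] at hp
    have hc : ContinuousOn (fun a => Ψ a - φ a - ⟪p, a⟫) K :=
      (hΨc.sub hφc).sub (by fun_prop)
    obtain ⟨x, hxK, hx⟩ := hK.exists_isMaxOn ⟨z₀, hz₀⟩ hc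
    have hx' : ∀ b ∈ K, Ψ b - φ b - ⟪p, b - x⟫ ≤ Ψ x - φ x := by
      intro b hb
      have : Ψ b - φ b - ⟪p, b⟫ ≤ Ψ x - φ x - ⟪p, x⟫ := hx hb
      rw [inner_sub_right]; linarith
    refine ⟨x, ?_, hx'⟩
    by_contra hxi
    have e1 := hgap x hxK hxi
    have e2 := hx' z₀ hz₀
    have e3 : ⟪p, z₀ - x⟫ < m := by
      calc ⟪p, z₀ - x⟫ ≤ ‖p‖ * ‖z₀ - x‖ := real_inner_le_norm _ _
        _ ≤ (m / (D + 1)) * D := by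
          gcongr
          · exact hp.le.trans (min_le_right _ _)
          · exact hKD x hxK
        _ < m := by rw [div_mul_eq_mul_div, div_lt_iff₀ (by positivity)]; nlinarith
    linarith
  -- at a contact point the function lies below a paraboloid, hence its subgradient is unique
  have hslope : ∀ p x, x ∈ interior K → (∀ b ∈ K, Ψ b - φ b - ⟪p, b - x⟫ ≤ Ψ x - φ x) →
      q x = G x + p + (lam : ℝ) • x ∧ ∀ b ∈ K, ψ b ≤ ψ x + ⟪q x, b - x⟫ + Λ / 2 * ‖b - x‖ ^ 2 := by
    intro p x hx hxp
    have hxK := interior_subset hx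
    have hup : ∀ b ∈ K,
        ψ b ≤ ψ x + ⟪G x + p + (lam : ℝ) • x, b - x⟫ + Λ / 2 * ‖b - x‖ ^ 2 := by
      intro b hb
      have e1 := hxp b hb
      have e2 := hφ x hxK b hb
      rw [inner_add_left, inner_add_left, real_inner_smul_left]
      simp only [hψ, hΛ]
      rw [hsq x b]
      linarith
    have heq : q x - (G x + p + (lam : ℝ) • x) = 0 := by
      refine eq_zero_of_inner_le_sq (Λ := Λ / 2) ?_
      have : Tendsto (fun h : F => x + h) (𝓝 0) (𝓝 x) := by
        simpa using (tendsto_const_nhds (x := x)).add (tendsto_id (x := 𝓝 (0 : F)))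
      filter_upwards [this (mem_interior_iff_mem_nhds.1 hx)] with h hh
      have hh : x + h ∈ K := hh
      have e1 := hq x hxK _ hh
      have e2 := hup _ hh
      rw [add_sub_cancel_left] at e1 e2
      rw [inner_sub_left]; linarith
    have heq := sub_eq_zero.1 heq
    exact ⟨heq, heq ▸ hup⟩
  set Y : Set F := {y | ∃ p ∈ ball (0 : F) δ', ∃ x ∈ interior K,
    (∀ b ∈ K, Ψ b - φ b - ⟪p, b - x⟫ ≤ Ψ x - φ x) ∧ y = x + q x} with hY
  have hJY : ∀ x ∈ K, J (x + q x) = x := fun x hx => hJK x hx _ (hq x hx)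
  -- the perturbation is a Lipschitz function of the point `x + q x`
  have hP : LipschitzOnWith (1 + CJ + lam * CJ + C * CJ)
      (fun y => y - J y - (lam : ℝ) • J y - G (J y)) Y := by
    have hGJ : LipschitzOnWith (C * CJ) (fun y => G (J y)) Y := by
      refine hG.comp (hJ.lipschitzOnWith (s := Y)) ?_
      rintro y ⟨p, -, x, hx, -, rfl⟩
      rw [hJY x (interior_subset hx)]
      exact interior_subset hx
    have hsm : LipschitzWith (lam * CJ) (fun y => (lam : ℝ) • J y) := by
      refine LipschitzWith.of_dist_le_mul fun a b => ?_
      rw [dist_smul₀, Real.norm_of_nonneg lam.coe_nonneg, NNReal.coe_mul, mul_assoc]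
      exact mul_le_mul_of_nonneg_left (hJ.dist_le_mul a b) lam.2
    exact (((LipschitzWith.id.sub hJ).sub hsm).lipschitzOnWith (s := Y)).sub hGJ
  obtain ⟨y, ⟨p, hp, x, hx, hxp, rfl⟩, hdiff⟩ :=
    exists_mem_differentiableAt_of_ball_subset_image hJ hP (c := 0) hδ'0 (by
      intro p hp
      obtain ⟨x, hx, hxp⟩ := hcontact p hp
      refine ⟨x + q x, ⟨p, hp, x, hx, hxp, rfl⟩, ?_⟩
      simp only
      rw [hJY x (interior_subset hx), (hslope p x hx hxp).1]
      abel)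
  obtain ⟨hqx, hup⟩ := hslope p x hx hxp
  have hxn : K ∈ 𝓝 x := mem_interior_iff_mem_nhds.1 hx
  have hqlip := norm_subgradient_sub_le hΛ0 hxn (fun a ha => hq a ha) hup
  obtain ⟨B, hB, hBd⟩ := exists_hasFDerivAt_of_leftInverse (J := J) (Y := fun a => a + q a) (x := x)
    (C := 1 + 2 * Λ) (by positivity) hdiff
    (by filter_upwards [hxn] with a ha using hJY a ha)
    (by
      filter_upwards [hqlip] with a ha
      calc ‖a + q a - (x + q x)‖ = ‖(a - x) + (q a - q x)‖ := by congr 1; abel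
        _ ≤ ‖a - x‖ + ‖q a - q x‖ := norm_add_le _ _
        _ ≤ _ := by linarith)
  have hqd : HasFDerivAt q (B - ContinuousLinearMap.id ℝ F) x := by
    have := hBd.sub (hasFDerivAt_id x)
    refine this.congr_of_eventuallyEq (Eventually.of_forall fun a => ?_)
    simp
  refine ⟨x, hx, p, B - ContinuousLinearMap.id ℝ F - (lam : ℝ) • ContinuousLinearMap.id ℝ F,
    (mem_ball_zero_iff.1 hp).le.trans (min_le_left _ _), ?_, hxp, fun ε hε => ?_⟩
  · refine (norm_sub_le _ _).trans (add_le_add ((norm_sub_le _ _).trans (add_le_add hB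
      ContinuousLinearMap.norm_id_le)) ?_)
    rw [norm_smul, Real.norm_of_nonneg lam.coe_nonneg]
    exact mul_le_of_le_one_right lam.2 ContinuousLinearMap.norm_id_le
  · filter_upwards [second_order_expansion_of_subgradient hxn (fun a ha => hq a ha) hqd hε] with h hh
    have e1 := hsq x (x + h)
    rw [add_sub_cancel_left] at e1
    have e2 : ψ (x + h) - ψ x - ⟪q x, h⟫ - ⟪(B - ContinuousLinearMap.id ℝ F) h, h⟫ / 2
        = Ψ (x + h) - Ψ x - ⟪G x + p, h⟫ - ⟪(B - ContinuousLinearMap.id ℝ F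
          - (lam : ℝ) • ContinuousLinearMap.id ℝ F) h, h⟫ / 2 := by
      simp only [hψ]
      rw [e1, hqx, inner_add_left (G x + p), real_inner_smul_left,
        sub_apply (B - _), inner_sub_left (_ : F) ((_ : F →L[ℝ] F) h) h]
      simp only [smul_apply, ContinuousLinearMap.id_apply,
        real_inner_smul_left, real_inner_self_eq_norm_sq]
      ring
    rwa [e2] at hh

end

/-! ### Sup-convolutions and parabolic jets -/

section
variable {E : Type*} [NormedAddCommGroup E]

/-- `U` is the sup-convolution with parameter `ε` of the restriction of `v` to `Q`, and `m` selects
a point of `Q` at which the supremum is attained. -/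
structure IsSupConv (Q : Set E) (v : E → ℝ) (ε : ℝ) (U : E → ℝ) (m : E → E) : Prop where
  mem : ∀ z, m z ∈ Q
  eq : ∀ z, U z = v (m z) - ‖z - m z‖ ^ 2 / (2 * ε)
  le : ∀ z, ∀ w ∈ Q, v w - ‖z - w‖ ^ 2 / (2 * ε) ≤ U z

lemma exists_isSupConv {Q : Set E} (hQ : IsCompact Q) (hne : Q.Nonempty) {v : E → ℝ}
    (hv : ContinuousOn v Q) (ε : ℝ) : ∃ U m, IsSupConv Q v ε U m := by
  have h : ∀ z : E, ∃ w ∈ Q, ∀ w' ∈ Q, v w' - ‖z - w'‖ ^ 2 / (2 * ε) ≤ v w - ‖z - w‖ ^ 2 / (2 * ε) := by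
    intro z
    have hc : ContinuousOn (fun w => v w - ‖z - w‖ ^ 2 / (2 * ε)) Q :=
      hv.sub (Continuous.continuousOn (by fun_prop))
    obtain ⟨w, hw, hmax⟩ := hQ.exists_isMaxOn hne hc
    exact ⟨w, hw, fun w' hw' => hmax hw'⟩
  choose m hm hmax using h
  exact ⟨fun z => v (m z) - ‖z - m z‖ ^ 2 / (2 * ε), m, hm, fun _ => rfl, hmax⟩

lemma IsSupConv.le_self {Q : Set E} {v U : E → ℝ} {m : E → E} {ε : ℝ}
    (h : IsSupConv Q v ε U m) {z : E} (hz : z ∈ Q) : v z ≤ U z := by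
  simpa using h.le z z hz

end

section
variable {E : Type*} [NormedAddCommGroup E] [InnerProductSpace ℝ E]

/-- `U` has at `z` the second order expansion with slope `q` and quadratic form `⟪A h, h⟫`. -/
def HasSecondOrderAt (U : E → ℝ) (q : E) (A : E →L[ℝ] E) (z : E) : Prop :=
  ∀ ε > 0, ∀ᶠ h in 𝓝 (0 : E), |U (z + h) - U z - ⟪q, h⟫ - ⟪A h, h⟫ / 2| ≤ ε * ‖h‖ ^ 2

namespace IsSupConv
variable {Q : Set E} {v U : E → ℝ} {m : E → E} {ε : ℝ}

/-- The paraboloid centred at `m a` touches `U` from below at `a`; this is the semiconvexity of `U`. -/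
lemma semiconvex (h : IsSupConv Q v ε U m) (hε : 0 < ε) (a b : E) :
    U a + ⟪ε⁻¹ • (m a - a), b - a⟫ - ε⁻¹ / 2 * ‖b - a‖ ^ 2 ≤ U b := by
  have h1 := h.le b (m a) (h.mem a)
  have h2 := norm_add_sq_real (b - a) (a - m a)
  rw [sub_add_sub_cancel] at h2
  have h3 : ⟪ε⁻¹ • (m a - a), b - a⟫ = - (ε⁻¹ * ⟪b - a, a - m a⟫) := by
    rw [real_inner_smul_left, real_inner_comm, ← neg_sub a (m a), inner_neg_right]; ring
  rw [h3, h.eq a]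
  rw [h2] at h1
  refine le_trans (le_of_eq ?_) h1
  field_simp
  ring

lemma continuous (h : IsSupConv Q v ε U m) (hε : 0 < ε) (hQ : IsCompact Q) : Continuous U := by
  obtain ⟨D, hD⟩ := hQ.isBounded.exists_norm_le
  have key : ∀ a b, U a - U b ≤ ε⁻¹ * ((‖a‖ + D) * ‖b - a‖ + ‖b - a‖ ^ 2) := by
    intro a b
    have h1 := h.semiconvex hε a b
    have h2 := abs_real_inner_le_norm (ε⁻¹ • (m a - a)) (b - a)
    have h3 : ‖m a - a‖ ≤ ‖a‖ + D := by
      have := norm_sub_le (m a) a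
      linarith [hD _ (h.mem a)]
    rw [norm_smul, Real.norm_of_nonneg (inv_nonneg.2 hε.le)] at h2
    have h4 := neg_le_of_abs_le h2
    have hi : 0 < ε⁻¹ := inv_pos.2 hε
    have h5 : ε⁻¹ * ‖m a - a‖ * ‖b - a‖ ≤ ε⁻¹ * (‖a‖ + D) * ‖b - a‖ := by gcongr
    have h6 : 0 ≤ ε⁻¹ * ‖b - a‖ ^ 2 := by positivity
    nlinarith
  rw [continuous_iff_continuousAt]
  intro a
  rw [ContinuousAt, tendsto_iff_norm_sub_tendsto_zero]
  have hlim : Tendsto (fun b => ε⁻¹ * ((‖a‖ + ‖b‖ + |D|) * ‖b - a‖ + ‖b - a‖ ^ 2)) (𝓝 a) (𝓝 0) := by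
    have hc : Continuous fun b => ε⁻¹ * ((‖a‖ + ‖b‖ + |D|) * ‖b - a‖ + ‖b - a‖ ^ 2) := by fun_prop
    simpa using hc.tendsto a
  refine squeeze_zero (fun _ => norm_nonneg _) (fun b => ?_) hlim
  have hi : 0 < ε⁻¹ := inv_pos.2 hε
  have hDa := le_abs_self D
  rw [Real.norm_eq_abs, abs_le]
  constructor
  · have := key a b
    have : ε⁻¹ * ((‖a‖ + D) * ‖b - a‖ + ‖b - a‖ ^ 2)
        ≤ ε⁻¹ * ((‖a‖ + ‖b‖ + |D|) * ‖b - a‖ + ‖b - a‖ ^ 2) := by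
      gcongr; linarith [norm_nonneg b]
    linarith
  · have := key b a
    rw [norm_sub_rev a b] at this
    have : ε⁻¹ * ((‖b‖ + D) * ‖b - a‖ + ‖b - a‖ ^ 2)
        ≤ ε⁻¹ * ((‖a‖ + ‖b‖ + |D|) * ‖b - a‖ + ‖b - a‖ ^ 2) := by
      gcongr; linarith [norm_nonneg a]
    linarith

/-- A second order expansion of the sup-convolution at `z` is an upper expansion of `v` at the point
`m z` where the supremum is attained, with the same slope and Hessian. -/
lemma expansion_le (h : IsSupConv Q v ε U m) {z q : E} {A : E →L[ℝ] E}
    (hU : HasSecondOrderAt U q A z) (hz : Q ∈ 𝓝 (m z)) {ε' : ℝ} (hε' : 0 < ε') :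
    ∀ᶠ k in 𝓝 (0 : E), v (m z + k) ≤ v (m z) + ⟪q, k⟫ + ⟪A k, k⟫ / 2 + ε' * ‖k‖ ^ 2 := by
  have ht : Tendsto (fun k : E => m z + k) (𝓝 0) (𝓝 (m z)) := by
    simpa using (tendsto_const_nhds (x := m z)).add (tendsto_id (x := 𝓝 (0 : E)))
  filter_upwards [hU ε' hε', ht hz] with k hk hkQ
  have h1 := h.le (z + k) (m z + k) hkQ
  rw [add_sub_add_right_eq_sub] at h1
  have h2 := (abs_le.1 hk).2
  rw [h.eq z] at h2
  linarith

end IsSupConv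

/-- The second order condition at a maximum of `U + W` along the common direction `k`. -/
lemma inner_add_inner_nonpos_of_second_order {U W : E → ℝ} {q₁ q₂ z₁ z₂ k : E}
    {A₁ A₂ : E →L[ℝ] E} (hU : HasSecondOrderAt U q₁ A₁ z₁) (hW : HasSecondOrderAt W q₂ A₂ z₂)
    (h : ∀ᶠ t in 𝓝 (0 : ℝ), U (z₁ + t • k) + W (z₂ + t • k) - t * ⟪q₁ + q₂, k⟫ ≤ U z₁ + W z₂) :
    ⟪A₁ k, k⟫ + ⟪A₂ k, k⟫ ≤ 0 := by
  have ht : Tendsto (fun t : ℝ => t • k) (𝓝[>] 0) (𝓝 0) := by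
    have : Continuous fun t : ℝ => t • k := by fun_prop
    have h4 := this.tendsto 0
    rw [zero_smul] at h4
    exact h4.mono_left nhdsWithin_le_nhds
  have key : ∀ ε > 0, ⟪A₁ k, k⟫ + ⟪A₂ k, k⟫ ≤ 0 + ε * (4 * ‖k‖ ^ 2) := by
    intro ε hε
    obtain ⟨t, ⟨⟨h1, h2⟩, h3⟩, ht0⟩ := (((ht.eventually (hU ε hε)).and (ht.eventually (hW ε hε))).and
      (nhdsWithin_le_nhds h) |>.and self_mem_nhdsWithin).exists
    have ht0 : 0 < t := ht0
    have h1 := (abs_le.1 h1).1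
    have h2 := (abs_le.1 h2).1
    simp only [map_smul, real_inner_smul_left, real_inner_smul_right, norm_smul,
      Real.norm_of_nonneg ht0.le] at h1 h2
    rw [inner_add_left] at h3
    have h4 : t ^ 2 * (⟪A₁ k, k⟫ + ⟪A₂ k, k⟫) ≤ t ^ 2 * (0 + ε * (4 * ‖k‖ ^ 2)) := by nlinarith
    exact le_of_mul_le_mul_left h4 (by positivity)
  by_contra! hcon
  have := key ((⟪A₁ k, k⟫ + ⟪A₂ k, k⟫) / (4 * ‖k‖ ^ 2 + 1) / 2) (by positivity)
  rw [zero_add, div_div, div_mul_eq_mul_div, le_div_iff₀ (by positivity)] at this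
  nlinarith [norm_nonneg k, mul_nonneg hcon.le (sq_nonneg ‖k‖)]

end

section Prod
variable {α β : Type*} [NormedAddCommGroup α] [InnerProductSpace ℝ α] [NormedAddCommGroup β]
  [InnerProductSpace ℝ β]

/-- The embedding `a ↦ (a, 0)` into the `L²` product. -/
def l2inl (α β : Type*) [NormedAddCommGroup α] [InnerProductSpace ℝ α] [NormedAddCommGroup β]
    [InnerProductSpace ℝ β] : α →L[ℝ] WithLp 2 (α × β) :=
  ((WithLp.prodContinuousLinearEquiv 2 ℝ α β).symm : α × β →L[ℝ] WithLp 2 (α × β)).comp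
    (ContinuousLinearMap.inl ℝ α β)

/-- The embedding `b ↦ (0, b)` into the `L²` product. -/
def l2inr (α β : Type*) [NormedAddCommGroup α] [InnerProductSpace ℝ α] [NormedAddCommGroup β]
    [InnerProductSpace ℝ β] : β →L[ℝ] WithLp 2 (α × β) :=
  ((WithLp.prodContinuousLinearEquiv 2 ℝ α β).symm : α × β →L[ℝ] WithLp 2 (α × β)).comp
    (ContinuousLinearMap.inr ℝ α β)

@[simp] lemma l2inl_fst (a : α) : (l2inl α β a).fst = a := rfl
@[simp] lemma l2inl_snd (a : α) : (l2inl α β a).snd = 0 := rfl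
@[simp] lemma l2inr_fst (b : β) : (l2inr α β b).fst = 0 := rfl
@[simp] lemma l2inr_snd (b : β) : (l2inr α β b).snd = b := rfl

lemma norm_l2inl (a : α) : ‖l2inl α β a‖ = ‖a‖ := by
  rw [← sq_eq_sq₀ (norm_nonneg _) (norm_nonneg _), WithLp.prod_norm_sq_eq_of_L2]; simp

lemma norm_l2inr (b : β) : ‖l2inr α β b‖ = ‖b‖ := by
  rw [← sq_eq_sq₀ (norm_nonneg _) (norm_nonneg _), WithLp.prod_norm_sq_eq_of_L2]; simp

lemma inner_l2inl (x : WithLp 2 (α × β)) (a : α) : ⟪x, l2inl α β a⟫ = ⟪x.fst, a⟫ := by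
  simp [WithLp.prod_inner_apply]

lemma inner_l2inr (x : WithLp 2 (α × β)) (b : β) : ⟪x, l2inr α β b⟫ = ⟪x.snd, b⟫ := by
  simp [WithLp.prod_inner_apply]

/-- The upper left block of an endomorphism of an `L²` product. -/
def blockFst (A : WithLp 2 (α × β) →L[ℝ] WithLp 2 (α × β)) : α →L[ℝ] α :=
  (WithLp.fstL 2 ℝ α β).comp (A.comp (l2inl α β))

/-- The lower right block of an endomorphism of an `L²` product. -/
def blockSnd (A : WithLp 2 (α × β) →L[ℝ] WithLp 2 (α × β)) : β →L[ℝ] β :=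
  (WithLp.sndL 2 ℝ α β).comp (A.comp (l2inr α β))

lemma inner_blockFst (A : WithLp 2 (α × β) →L[ℝ] WithLp 2 (α × β)) (a : α) :
    ⟪blockFst A a, a⟫ = ⟪A (l2inl α β a), l2inl α β a⟫ := by
  rw [inner_l2inl]; rfl

lemma inner_blockSnd (A : WithLp 2 (α × β) →L[ℝ] WithLp 2 (α × β)) (b : β) :
    ⟪blockSnd A b, b⟫ = ⟪A (l2inr α β b), l2inr α β b⟫ := by
  rw [inner_l2inr]; rfl

lemma norm_blockFst_le (A : WithLp 2 (α × β) →L[ℝ] WithLp 2 (α × β)) : ‖blockFst A‖ ≤ ‖A‖ := by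
  refine ContinuousLinearMap.opNorm_le_bound _ A.opNorm_nonneg fun a => ?_
  rw [← norm_l2inl (β := β) a]
  exact (WithLp.norm_fst_le _ (A (l2inl α β a))).trans (A.le_opNorm _)

lemma HasSecondOrderAt.fst {U : α → ℝ} {W : β → ℝ} {q z : WithLp 2 (α × β)}
    {A : WithLp 2 (α × β) →L[ℝ] WithLp 2 (α × β)}
    (h : HasSecondOrderAt (fun y : WithLp 2 (α × β) => U y.fst + W y.snd) q A z) :
    HasSecondOrderAt U q.fst (blockFst A) z.fst := by
  intro ε hε
  have ht : Tendsto (l2inl α β) (𝓝 0) (𝓝 0) := by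
    simpa using (l2inl α β).continuous.tendsto 0
  filter_upwards [ht.eventually (h ε hε)] with k hk
  simp only [WithLp.add_fst, WithLp.add_snd, l2inl_fst, l2inl_snd, add_zero, norm_l2inl] at hk
  rw [inner_l2inl, ← inner_blockFst] at hk
  convert hk using 2
  ring

lemma HasSecondOrderAt.snd {U : α → ℝ} {W : β → ℝ} {q z : WithLp 2 (α × β)}
    {A : WithLp 2 (α × β) →L[ℝ] WithLp 2 (α × β)}
    (h : HasSecondOrderAt (fun y : WithLp 2 (α × β) => U y.fst + W y.snd) q A z) :
    HasSecondOrderAt W q.snd (blockSnd A) z.snd := by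
  intro ε hε
  have ht : Tendsto (l2inr α β) (𝓝 0) (𝓝 0) := by
    simpa using (l2inr α β).continuous.tendsto 0
  filter_upwards [ht.eventually (h ε hε)] with k hk
  simp only [WithLp.add_fst, WithLp.add_snd, l2inr_fst, l2inr_snd, add_zero, norm_l2inr] at hk
  rw [inner_l2inr, ← inner_blockSnd] at hk
  convert hk using 2
  ring

end Prod

section Jets

/-- Space-time `ℝⁿ × ℝ` with its Euclidean norm. -/
abbrev SpaceTime (n : ℕ) : Type := WithLp 2 (Eucl n × ℝ)

/-- The symmetric part of the spatial block of an endomorphism of space-time. -/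
def spatialHess {n : ℕ} (A : SpaceTime n →L[ℝ] SpaceTime n) : Endo n :=
  (2⁻¹ : ℝ) • (blockFst A + ContinuousLinearMap.adjoint (blockFst A))

variable {n : ℕ} (A : SpaceTime n →L[ℝ] SpaceTime n)

lemma isSymmetric_spatialHess : (spatialHess A : Eucl n →ₗ[ℝ] Eucl n).IsSymmetric := by
  intro x y
  simp only [spatialHess, ContinuousLinearMap.coe_coe, smul_apply, add_apply,
    real_inner_smul_left, real_inner_smul_right, inner_add_left, inner_add_right,
    ContinuousLinearMap.adjoint_inner_left, ContinuousLinearMap.adjoint_inner_right]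
  ring

lemma inner_spatialHess (ξ : Eucl n) :
    ⟪spatialHess A ξ, ξ⟫ = ⟪A (l2inl _ _ ξ), l2inl _ _ ξ⟫ := by
  rw [← inner_blockFst]
  simp only [spatialHess, smul_apply, add_apply,
    real_inner_smul_left, inner_add_left, ContinuousLinearMap.adjoint_inner_left]
  rw [real_inner_comm ξ]
  ring

lemma norm_spatialHess_le : ‖spatialHess A‖ ≤ ‖A‖ := by
  rw [spatialHess, norm_smul]
  have h1 := norm_add_le (blockFst A) (ContinuousLinearMap.adjoint (blockFst A))
  rw [LinearIsometryEquiv.norm_map] at h1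
  have h2 := norm_blockFst_le A
  rw [Real.norm_of_nonneg (by norm_num)]
  linarith

/-- An upper second order expansion in space-time gives a parabolic superjet: the mixed and the purely
temporal second order terms are `o(|s - t|)`. -/
lemma isSuperjet_of_expansion {u : Eucl n → ℝ → ℝ} {w q : SpaceTime n}
    (h : ∀ ε > 0, ∀ᶠ k in 𝓝 (0 : SpaceTime n), u (w + k).fst (w + k).snd
      ≤ u w.fst w.snd + ⟪q, k⟫ + ⟪A k, k⟫ / 2 + ε * ‖k‖ ^ 2) :
    IsSuperjet u w.fst w.snd q.snd q.fst (spatialHess A) := by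
  refine ⟨isSymmetric_spatialHess A, fun ε hε => ?_⟩
  have ht : Tendsto (fun z : Eucl n × ℝ => (WithLp.toLp 2 z : SpaceTime n) - w)
      (𝓝 (w.fst, w.snd)) (𝓝 0) := by
    have hc : Continuous fun z : Eucl n × ℝ => (WithLp.toLp 2 z : SpaceTime n) - w :=
      (WithLp.prod_continuous_toLp 2 _ _).sub continuous_const
    have := hc.tendsto (w.fst, w.snd)
    convert this using 2
    exact (sub_self w).symm
  set c : ℝ := ε / (4 * (‖A‖ + 1)) with hc
  have hA := norm_nonneg A
  have hc0 : 0 < c := by positivity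
  have hcA : c * ‖A‖ ≤ ε / 4 := by
    rw [hc, div_mul_eq_mul_div, div_le_div_iff₀ (by positivity) (by norm_num)]
    nlinarith
  have hsmall : ∀ᶠ k in 𝓝 (0 : SpaceTime n), ‖k‖ < min c 1 := by
    have : ball (0 : SpaceTime n) (min c 1) ∈ 𝓝 0 := ball_mem_nhds _ (by positivity)
    filter_upwards [this] with k hk using mem_ball_zero_iff.1 hk
  filter_upwards [ht.eventually ((h (ε / 2) (half_pos hε)).and hsmall)] with z hz
  obtain ⟨hz, hzs⟩ := hz
  set k : SpaceTime n := (WithLp.toLp 2 z : SpaceTime n) - w with hk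
  have hwk : w + k = WithLp.toLp 2 z := by rw [hk]; abel
  have hk1 : k.fst = z.1 - w.fst := rfl
  have hk2 : k.snd = z.2 - w.snd := rfl
  rw [hwk] at hz
  have hz' : u z.1 z.2 ≤ u w.fst w.snd + ⟪q, k⟫ + ⟪A k, k⟫ / 2 + ε / 2 * ‖k‖ ^ 2 := hz
  have e1 : ⟪q, k⟫ = q.snd * (z.2 - w.snd) + ⟪q.fst, z.1 - w.fst⟫ := by
    rw [WithLp.prod_inner_apply, ← hk1, ← hk2]
    simp [mul_comm, add_comm]
  have e2 : ‖k‖ ^ 2 = ‖z.1 - w.fst‖ ^ 2 + |z.2 - w.snd| ^ 2 := by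
    rw [WithLp.prod_norm_sq_eq_of_L2, ← hk1, ← hk2, Real.norm_eq_abs]
  set a := l2inl (Eucl n) ℝ k.fst with ha
  set b := l2inr (Eucl n) ℝ k.snd with hb
  have hab : k = a + b := by
    refine WithLp.ofLp_injective 2 (Prod.ext ?_ ?_)
    · change k.fst = a.fst + b.fst
      simp [ha, hb]
    · change k.snd = a.snd + b.snd
      simp [ha, hb]
  have hbn : ‖b‖ = |z.2 - w.snd| := by rw [hb, norm_l2inr, hk2, Real.norm_eq_abs]
  have hbk : ‖b‖ ≤ ‖k‖ := by rw [hb, norm_l2inr]; exact WithLp.norm_snd_le _ k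
  have hak : ‖a‖ ≤ ‖k‖ := by rw [ha, norm_l2inl]; exact WithLp.norm_fst_le _ k
  have e3 : ⟪A k, k⟫ ≤ ⟪spatialHess A (z.1 - w.fst), z.1 - w.fst⟫ + 2 * (‖A‖ * ‖k‖ * ‖b‖) := by
    rw [inner_spatialHess, ← hk1, ← ha]
    have e4 : ⟪A k, k⟫ = ⟪A a, a⟫ + ⟪A b, a⟫ + ⟪A k, b⟫ := by
      conv_lhs => rw [hab, inner_add_right]
      rw [← hab]
      conv_lhs => rw [hab]
      rw [map_add, inner_add_left, ← map_add, ← hab]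
    have e5 : ⟪A b, a⟫ ≤ ‖A‖ * ‖k‖ * ‖b‖ := by
      calc ⟪A b, a⟫ ≤ ‖A b‖ * ‖a‖ := real_inner_le_norm _ _
        _ ≤ (‖A‖ * ‖b‖) * ‖k‖ := by gcongr; exact A.le_opNorm b
        _ = _ := by ring
    have e6 : ⟪A k, b⟫ ≤ ‖A‖ * ‖k‖ * ‖b‖ := by
      calc ⟪A k, b⟫ ≤ ‖A k‖ * ‖b‖ := real_inner_le_norm _ _
        _ ≤ _ := by gcongr; exact A.le_opNorm k
    linarith
  have hkc : ‖k‖ ≤ c := (hzs.trans_le (min_le_left _ _)).le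
  have hk1' : ‖k‖ ≤ 1 := (hzs.trans_le (min_le_right _ _)).le
  have e7 : ‖A‖ * ‖k‖ * ‖b‖ ≤ ε / 4 * |z.2 - w.snd| := by
    rw [hbn]
    gcongr
    calc ‖A‖ * ‖k‖ ≤ ‖A‖ * c := by gcongr
      _ ≤ ε / 4 := by linarith
  have e8 : |z.2 - w.snd| ^ 2 ≤ |z.2 - w.snd| := by
    have : |z.2 - w.snd| ≤ 1 := by rw [← hbn]; exact hbk.trans hk1'
    nlinarith [abs_nonneg (z.2 - w.snd)]
  rw [e1, e2] at hz'
  have e9 : 0 ≤ ε * ‖z.1 - w.fst‖ ^ 2 := by positivity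
  have e10 : ε / 2 * |z.2 - w.snd| ^ 2 ≤ ε / 2 * |z.2 - w.snd| := by gcongr
  have e11 : 0 ≤ ε * |z.2 - w.snd| := by positivity
  linarith

lemma IsSuperjet.isSubjet_neg {u : Eucl n → ℝ → ℝ} {x : Eucl n} {t τ : ℝ} {p : Eucl n} {X : Endo n}
    (h : IsSuperjet (fun y s => -u y s) x t τ p X) : IsSubjet u x t (-τ) (-p) (-X) := by
  refine ⟨fun a b => ?_, fun ε hε => ?_⟩
  · have := h.1 a b
    simpa using this
  · filter_upwards [h.2 ε hε] with z hz
    simp only [neg_apply, inner_neg_left]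
    linarith

end Jets

/-! ### The level set operator at nonzero slopes -/

section Operator
variable {n : ℕ} {σ : Eucl n → ℝ} {g f : Eucl n → ℝ → ℝ}

lemma contDiffAt_of_ne_zero (hσ : ContDiffOn ℝ 2 σ {0}ᶜ) {p : Eucl n} (hp : p ≠ 0) :
    ContDiffAt ℝ 2 σ p :=
  hσ.contDiffAt (isOpen_compl_singleton.mem_nhds hp)

lemma gradient_eq_toDual_symm (σ : Eucl n → ℝ) :
    gradient σ = fun p => (InnerProductSpace.toDual ℝ (Eucl n)).symm (fderiv ℝ σ p) := rfl

lemma contDiffAt_gradient (hσ : ContDiffOn ℝ 2 σ {0}ᶜ) {p : Eucl n} (hp : p ≠ 0) :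
    ContDiffAt ℝ 1 (gradient σ) p := by
  rw [gradient_eq_toDual_symm]
  exact (InnerProductSpace.toDual ℝ (Eucl n)).symm.contDiff.contDiffAt.comp p
    ((contDiffAt_of_ne_zero hσ hp).fderiv_right (m := 1) (by norm_num))

lemma continuousAt_hess (hσ : ContDiffOn ℝ 2 σ {0}ᶜ) {p : Eucl n} (hp : p ≠ 0) :
    ContinuousAt (hess σ) p :=
  ((contDiffAt_gradient hσ hp).fderiv_right (m := 0) (by norm_num)).continuousAt

lemma inner_hess (hσ : ContDiffOn ℝ 2 σ {0}ᶜ) {p : Eucl n} (hp : p ≠ 0) (v w : Eucl n) :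
    ⟪hess σ p v, w⟫ = fderiv ℝ (fderiv ℝ σ) p v w := by
  have h1 : DifferentiableAt ℝ (fderiv ℝ σ) p :=
    ((contDiffAt_of_ne_zero hσ hp).fderiv_right (m := 1) (by norm_num)).differentiableAt (by norm_num)
  have h2 : HasFDerivAt (gradient σ) (hess σ p) p :=
    ((contDiffAt_gradient hσ hp).differentiableAt (by norm_num)).hasFDerivAt
  have h3 : HasFDerivAt (fun q => ⟪w, gradient σ q⟫) ((innerSL ℝ w).comp (hess σ p)) p :=
    (innerSL ℝ w).hasFDerivAt.comp p h2
  have h4 : HasFDerivAt (fun q => fderiv ℝ σ q w)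
      ((ContinuousLinearMap.apply ℝ ℝ w).comp (fderiv ℝ (fderiv ℝ σ) p)) p :=
    (ContinuousLinearMap.apply ℝ ℝ w).hasFDerivAt.comp p h1.hasFDerivAt
  have h5 : (fun q => ⟪w, gradient σ q⟫) = fun q => fderiv ℝ σ q w := by
    funext q
    rw [real_inner_comm, inner_gradient_left]
  rw [h5] at h3
  rw [real_inner_comm]
  exact DFunLike.congr_fun (h3.unique h4) v

lemma isSymmetric_hess (hσ : ContDiffOn ℝ 2 σ {0}ᶜ) {p : Eucl n} (hp : p ≠ 0) :
    (hess σ p : Eucl n →ₗ[ℝ] Eucl n).IsSymmetric := by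
  intro v w
  have h := (contDiffAt_of_ne_zero hσ hp).isSymmSndFDerivAt (by simp)
  simp only [ContinuousLinearMap.coe_coe]
  rw [inner_hess hσ hp, real_inner_comm, inner_hess hσ hp]
  exact h v w

lemma inner_hess_nonneg (hσ : ContDiffOn ℝ 2 σ {0}ᶜ) (hconv : ConvexOn ℝ univ σ) {p : Eucl n}
    (hp : p ≠ 0) (v : Eucl n) : 0 ≤ ⟪hess σ p v, v⟫ := by
  -- monotonicity of the gradient
  have hgrad : ∀ a b : Eucl n, a ≠ 0 → σ a + ⟪gradient σ a, b - a⟫ ≤ σ b := by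
    intro a b ha
    have hd : HasFDerivAt σ (fderiv ℝ σ a) a :=
      ((contDiffAt_of_ne_zero hσ ha).differentiableAt (by norm_num)).hasFDerivAt
    have hline : HasDerivAt (fun t : ℝ => a + t • (b - a)) (b - a) 0 := by
      simpa using ((hasDerivAt_id (0 : ℝ)).smul_const (b - a)).const_add a
    have hd' : HasDerivAt (fun t : ℝ => σ (a + t • (b - a))) (fderiv ℝ σ a (b - a)) 0 := by
      have hd0 : HasFDerivAt σ (fderiv ℝ σ a) (a + (0 : ℝ) • (b - a)) := by simpa using hd
      exact hd0.comp_hasDerivAt 0 hline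
    have hc : ConvexOn ℝ univ (fun t : ℝ => σ (a + t • (b - a))) := by
      refine ⟨convex_univ, fun s _ t _ α β hα hβ hαβ => ?_⟩
      have := hconv.2 (mem_univ (a + s • (b - a))) (mem_univ (a + t • (b - a))) hα hβ hαβ
      refine le_trans (le_of_eq ?_) this
      simp only
      congr 1
      have hα' : α = 1 - β := by linarith
      subst hα'
      simp only [smul_eq_mul, smul_add, add_smul, sub_smul, one_smul, smul_smul]
      module
    have := hc.le_slope_of_hasDerivAt (mem_univ 0) (mem_univ 1) one_pos hd'
    rw [slope_def_field] at this
    simp only [one_smul, add_sub_cancel, zero_smul, add_zero, sub_zero, div_one] at this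
    rw [inner_gradient_left]
    linarith
  have hder : HasFDerivAt (gradient σ) (hess σ p) p :=
    ((contDiffAt_gradient hσ hp).differentiableAt (by norm_num)).hasFDerivAt
  have hline : HasDerivAt (fun t : ℝ => p + t • v) v 0 := by
    simpa using ((hasDerivAt_id (0 : ℝ)).smul_const v).const_add p
  have hd : HasDerivAt (fun t : ℝ => gradient σ (p + t • v)) (hess σ p v) 0 := by
    have hd0 : HasFDerivAt (gradient σ) (hess σ p) (p + (0 : ℝ) • v) := by simpa using hder
    exact hd0.comp_hasDerivAt 0 hline
  have hd' : HasDerivAt (fun t : ℝ => ⟪gradient σ (p + t • v), v⟫) ⟪hess σ p v, v⟫ 0 := by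
    simpa using hd.inner ℝ (hasDerivAt_const (0 : ℝ) v)
  have hslope := (hasDerivAt_iff_tendsto_slope.1 hd').mono_left
    (nhdsWithin_mono (0 : ℝ) (fun t (ht : t ∈ Ioi (0 : ℝ)) => (ne_of_gt ht : t ≠ 0)))
  refine ge_of_tendsto hslope ?_
  have hne : ∀ᶠ t in 𝓝[>] (0 : ℝ), p + t • v ≠ 0 := by
    have hc : Continuous fun t : ℝ => p + t • v := by fun_prop
    have := hc.tendsto 0
    rw [zero_smul, add_zero] at this
    exact (this.mono_left nhdsWithin_le_nhds).eventually (isOpen_compl_singleton.mem_nhds hp)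
  filter_upwards [hne, self_mem_nhdsWithin] with t ht ht0
  have ht0 : 0 < t := ht0
  have e1 := hgrad p (p + t • v) hp
  have e2 := hgrad (p + t • v) p ht
  rw [add_sub_cancel_left, real_inner_smul_right] at e1
  rw [sub_add_cancel_left, inner_neg_right, real_inner_smul_right] at e2
  rw [slope_def_field, zero_smul, add_zero, sub_zero]
  refine div_nonneg ?_ ht0.le
  have : 0 ≤ t * (⟪gradient σ (p + t • v), v⟫ - ⟪gradient σ p, v⟫) := by linarith
  exact nonneg_of_mul_nonneg_right this ht0

lemma endoTrace_comp_nonneg {A B : Endo n} (hA : (A : Eucl n →ₗ[ℝ] Eucl n).IsSymmetric)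
    (hA0 : ∀ v, 0 ≤ ⟪A v, v⟫) (hB0 : ∀ v, 0 ≤ ⟪B v, v⟫) : 0 ≤ endoTrace (A.comp B) := by
  have hn : Module.finrank ℝ (Eucl n) = n := by simp
  rw [endoTrace, LinearMap.trace_eq_sum_inner _ (hA.eigenvectorBasis hn)]
  refine Finset.sum_nonneg fun i _ => ?_
  set e := hA.eigenvectorBasis hn i
  have he : A e = hA.eigenvalues hn i • e := hA.apply_eigenvectorBasis hn i
  have hpos : 0 ≤ hA.eigenvalues hn i := by
    have h1 := hA0 e
    rw [he, real_inner_smul_left, real_inner_self_eq_norm_sq,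
      (hA.eigenvectorBasis hn).orthonormal.1 i] at h1
    simpa using h1
  have h2 : ⟪e, A (B e)⟫ = hA.eigenvalues hn i * ⟪B e, e⟫ := by
    have := hA e (B e)
    simp only [ContinuousLinearMap.coe_coe] at this
    rw [← this, he, real_inner_smul_left, real_inner_comm]
  change 0 ≤ ⟪e, A (B e)⟫
  rw [h2]
  exact mul_nonneg hpos (hB0 e)

lemma endoTrace_sub (A B : Endo n) : endoTrace (A - B) = endoTrace A - endoTrace B := by
  simp [endoTrace]

lemma continuous_endoTrace : Continuous (endoTrace : Endo n → ℝ) := by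
  let ℓ : Endo n →ₗ[ℝ] ℝ :=
    { toFun := endoTrace
      map_add' := fun A B => by simp [endoTrace]
      map_smul' := fun c A => by simp [endoTrace] }
  exact ℓ.continuous_of_finiteDimensional

/-- The level set operator with the value of the forcing term as an independent variable. -/
def frozenOp (σ : Eucl n → ℝ) (g : Eucl n → ℝ → ℝ) (q : Eucl n × Endo n × ℝ) : ℝ :=
  ‖q.1‖ * g (‖q.1‖⁻¹ • q.1) (-endoTrace ((hess σ q.1).comp q.2.1) + q.2.2)

lemma normalize_mem_sphere {p : Eucl n} (hp : p ≠ 0) : ‖p‖⁻¹ • p ∈ sphere (0 : Eucl n) 1 := by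
  rw [mem_sphere_zero_iff_norm, norm_smul, norm_inv, norm_norm, inv_mul_cancel₀ (norm_ne_zero_iff.2 hp)]

lemma continuousOn_frozenOp (hσ : ContDiffOn ℝ 2 σ {0}ᶜ)
    (hg : ContinuousOn (fun q : Eucl n × ℝ => g q.1 q.2) (sphere 0 1 ×ˢ univ)) :
    ContinuousOn (frozenOp σ g) {q | q.1 ≠ 0} := by
  have h1 : ContinuousOn (fun q : Eucl n × Endo n × ℝ => hess σ q.1) {q | q.1 ≠ 0} :=
    fun q hq => ((continuousAt_hess hσ hq).comp continuousAt_fst).continuousWithinAt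
  have h2 : ContinuousOn (fun q : Eucl n × Endo n × ℝ => -endoTrace ((hess σ q.1).comp q.2.1) + q.2.2)
      {q | q.1 ≠ 0} := by
    refine ContinuousOn.add (ContinuousOn.neg ?_) (by fun_prop)
    exact continuous_endoTrace.comp_continuousOn (h1.clm_comp (by fun_prop))
  have h3 : ContinuousOn (fun q : Eucl n × Endo n × ℝ => ‖q.1‖⁻¹ • q.1) {q | q.1 ≠ 0} :=
    (ContinuousOn.inv₀ (by fun_prop) (fun q hq => norm_ne_zero_iff.2 hq)).smul (by fun_prop)
  refine ContinuousOn.mul (by fun_prop) ?_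
  exact hg.comp (h3.prodMk h2) fun q hq => ⟨normalize_mem_sphere hq, mem_univ _⟩

/-- Degenerate ellipticity, from the convexity of `σ` and the monotonicity of `g`. -/
lemma frozenOp_mono (hσ : ContDiffOn ℝ 2 σ {0}ᶜ) (hconv : ConvexOn ℝ univ σ)
    (hg : ∀ ν ∈ sphere (0 : Eucl n) 1, Monotone (g ν)) {p : Eucl n} (hp : p ≠ 0) {X Y : Endo n}
    (hXY : ∀ v, ⟪X v, v⟫ ≤ ⟪Y v, v⟫) (r : ℝ) : frozenOp σ g (p, Y, r) ≤ frozenOp σ g (p, X, r) := by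
  refine mul_le_mul_of_nonneg_left (hg _ (normalize_mem_sphere hp) ?_) (norm_nonneg _)
  have h := endoTrace_comp_nonneg (isSymmetric_hess hσ hp) (inner_hess_nonneg hσ hconv hp)
    (B := Y - X) (fun v => by rw [sub_apply, inner_sub_left]; linarith [hXY v])
  rw [ContinuousLinearMap.comp_sub, endoTrace_sub] at h
  simp only
  linarith

lemma frozenOp_sub_le {Lg : ℝ≥0} (hg : ∀ ν ∈ sphere (0 : Eucl n) 1, LipschitzWith Lg (g ν))
    {p : Eucl n} (hp : p ≠ 0) (X : Endo n) (r s : ℝ) :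
    frozenOp σ g (p, X, r) - frozenOp σ g (p, X, s) ≤ ‖p‖ * (Lg * |r - s|) := by
  rw [frozenOp, frozenOp, ← mul_sub]
  refine mul_le_mul_of_nonneg_left ?_ (norm_nonneg _)
  refine (le_abs_self _).trans ?_
  have := (hg _ (normalize_mem_sphere hp)).dist_le_mul (-endoTrace ((hess σ p).comp X) + r)
    (-endoTrace ((hess σ p).comp X) + s)
  rw [Real.dist_eq, Real.dist_eq, add_sub_add_left_eq_sub] at this
  exact this

variable {T : ℝ} {u : Eucl n → ℝ → ℝ} {x : Eucl n} {t τ : ℝ} {p : Eucl n} {X : Endo n}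

/-- At slopes `p ≠ 0` the operator is continuous, so its envelopes coincide with it. -/
lemma tendsto_levelSetOp (hσ : ContDiffOn ℝ 2 σ {0}ᶜ)
    (hg : ContinuousOn (fun q : Eucl n × ℝ => g q.1 q.2) (sphere 0 1 ×ˢ univ))
    (hf : ContinuousOn (fun z : Eucl n × ℝ => f z.1 z.2) (univ ×ˢ Icc (0 : ℝ) T))
    (ht : t ∈ Ioo (0 : ℝ) T) (hp : p ≠ 0) :
    Tendsto (fun w => (levelSetOp σ g f w : EReal)) (𝓝[regularSet n] (x, t, p, X))
      (𝓝 ((frozenOp σ g (p, X, f x t) : ℝ) : EReal)) := by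
  have hf' : ContinuousAt (fun z : Eucl n × ℝ => f z.1 z.2) (x, t) :=
    hf.continuousAt (prod_mem_nhds univ_mem (Icc_mem_nhds ht.1 ht.2))
  have h1 : ContinuousAt (fun w : Eucl n × ℝ × Eucl n × Endo n => f w.1 w.2.1) (x, t, p, X) :=
    ContinuousAt.comp (g := fun z : Eucl n × ℝ => f z.1 z.2)
      (f := fun w : Eucl n × ℝ × Eucl n × Endo n => (w.1, w.2.1)) hf' (by fun_prop)
  have h2 : ContinuousAt (fun w : Eucl n × ℝ × Eucl n × Endo n => (w.2.2.1, w.2.2.2, f w.1 w.2.1))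
      (x, t, p, X) :=
    ContinuousAt.prodMk (by fun_prop) (ContinuousAt.prodMk (by fun_prop) h1)
  have hopen : IsOpen {q : Eucl n × Endo n × ℝ | q.1 ≠ 0} :=
    isOpen_compl_singleton.preimage continuous_fst
  have h3 : ContinuousAt (frozenOp σ g) (p, X, f x t) :=
    (continuousOn_frozenOp hσ hg).continuousAt (hopen.mem_nhds hp)
  have h4 : ContinuousAt (levelSetOp σ g f) (x, t, p, X) :=
    ContinuousAt.comp (g := frozenOp σ g)
      (f := fun w : Eucl n × ℝ × Eucl n × Endo n => (w.2.2.1, w.2.2.2, f w.1 w.2.1)) h3 h2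
  exact (continuous_coe_real_ereal.tendsto _).comp (h4.tendsto.mono_left nhdsWithin_le_nhds)

lemma neBot_nhdsWithin_regularSet (hp : p ≠ 0) (hX : (X : Eucl n →ₗ[ℝ] Eucl n).IsSymmetric) :
    (𝓝[regularSet n] (x, t, p, X)).NeBot :=
  nhdsWithin_neBot_of_mem (show (x, t, p, X) ∈ regularSet n from ⟨hp, hX⟩)

lemma IsViscSub.add_frozenOp_le (hu : IsViscSub σ g f T u) (hσ : ContDiffOn ℝ 2 σ {0}ᶜ)
    (hg : ContinuousOn (fun q : Eucl n × ℝ => g q.1 q.2) (sphere 0 1 ×ˢ univ))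
    (hf : ContinuousOn (fun z : Eucl n × ℝ => f z.1 z.2) (univ ×ˢ Icc (0 : ℝ) T))
    (ht : t ∈ Ioo (0 : ℝ) T) (hp : p ≠ 0) (h : IsSuperjet u x t τ p X) :
    τ + frozenOp σ g (p, X, f x t) ≤ 0 := by
  have := neBot_nhdsWithin_regularSet (x := x) (t := t) hp h.1
  have h1 := hu x t ht τ p X h
  rw [lowerEnv, (tendsto_levelSetOp hσ hg hf ht hp).liminf_eq] at h1
  exact_mod_cast h1

lemma IsViscSuper.add_frozenOp_nonneg (hu : IsViscSuper σ g f T u) (hσ : ContDiffOn ℝ 2 σ {0}ᶜ)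
    (hg : ContinuousOn (fun q : Eucl n × ℝ => g q.1 q.2) (sphere 0 1 ×ˢ univ))
    (hf : ContinuousOn (fun z : Eucl n × ℝ => f z.1 z.2) (univ ×ˢ Icc (0 : ℝ) T))
    (ht : t ∈ Ioo (0 : ℝ) T) (hp : p ≠ 0) (h : IsSubjet u x t τ p X) :
    0 ≤ τ + frozenOp σ g (p, X, f x t) := by
  have := neBot_nhdsWithin_regularSet (x := x) (t := t) hp h.1
  have h1 := hu x t ht τ p X h
  rw [upperEnv, (tendsto_levelSetOp hσ hg hf ht hp).limsup_eq] at h1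
  exact_mod_cast h1

end Operator

/-! ### Doubling the variables -/

section
variable {α β : Type*} [NormedAddCommGroup α] [NormedAddCommGroup β]

/-- The product of two sets, as a subset of the `L²` product. -/
def l2prod (s : Set α) (t : Set β) : Set (WithLp 2 (α × β)) := {z | z.fst ∈ s ∧ z.snd ∈ t}

lemma isCompact_l2prod {s : Set α} {t : Set β} (hs : IsCompact s) (ht : IsCompact t) :
    IsCompact (l2prod s t) := by
  have h := (hs.prod ht).image (WithLp.prod_continuous_toLp 2 α β)
  convert h using 1
  ext z
  constructor
  · intro hz
    exact ⟨(z.fst, z.snd), hz, rfl⟩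
  · rintro ⟨y, hy, rfl⟩
    exact hy

lemma l2prod_mem_nhds {s : Set α} {t : Set β} {z : WithLp 2 (α × β)} (hs : s ∈ 𝓝 z.fst)
    (ht : t ∈ 𝓝 z.snd) : l2prod s t ∈ 𝓝 z :=
  inter_mem ((WithLp.continuous_fst 2 α β).continuousAt hs)
    ((WithLp.continuous_snd 2 α β).continuousAt ht)

lemma norm_le_add_l2 (z : WithLp 2 (α × β)) : ‖z‖ ≤ ‖z.fst‖ + ‖z.snd‖ := by
  have h := WithLp.prod_norm_sq_eq_of_L2 z
  nlinarith [norm_nonneg z, norm_nonneg z.fst, norm_nonneg z.snd,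
    mul_nonneg (norm_nonneg z.fst) (norm_nonneg z.snd)]

lemma convex_l2prod [InnerProductSpace ℝ α] [InnerProductSpace ℝ β] {s : Set α} {t : Set β} (hs : Convex ℝ s) (ht : Convex ℝ t) :
    Convex ℝ (l2prod s t) :=
  (hs.linear_preimage (WithLp.fstL 2 ℝ α β : WithLp 2 (α × β) →ₗ[ℝ] α)).inter
    (ht.linear_preimage (WithLp.sndL 2 ℝ α β : WithLp 2 (α × β) →ₗ[ℝ] β))

end

section
variable {F : Type*} [NormedAddCommGroup F] [InnerProductSpace ℝ F] [CompleteSpace F]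

/-- The derivative of `φ` along a line, in terms of the gradient. -/
lemma hasDerivAt_comp_line {φ : F → ℝ} {z : F} (hφ : DifferentiableAt ℝ φ z) (h : F) :
    HasDerivAt (fun r : ℝ => φ (z + r • h)) ⟪gradient φ z, h⟫ 0 := by
  have hline : HasDerivAt (fun t : ℝ => z + t • h) h 0 := by
    simpa using ((hasDerivAt_id (0 : ℝ)).smul_const h).const_add z
  have hd : HasFDerivAt φ (fderiv ℝ φ z) (z + (0 : ℝ) • h) := by
    simpa using hφ.hasFDerivAt
  rw [inner_gradient_left]
  exact hd.comp_hasDerivAt 0 hline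

lemma ContDiff.exists_gradient_lipschitzOnWith {φ : F → ℝ} (hφ : ContDiff ℝ 2 φ) {K : Set F}
    (hK : IsCompact K) (hKc : Convex ℝ K) :
    ∃ C : ℝ≥0, LipschitzOnWith C (gradient φ) K ∧
      ∀ a ∈ K, ∀ b ∈ K, φ b ≤ φ a + ⟪gradient φ a, b - a⟫ + C / 2 * ‖b - a‖ ^ 2 := by
  have hg : ContDiff ℝ 1 (gradient φ) :=
    (InnerProductSpace.toDual ℝ F).symm.contDiff.comp (hφ.fderiv_right (m := 1) (by norm_num))
  obtain ⟨C, hC⟩ := hg.contDiffOn.exists_lipschitzOnWith one_ne_zero hKc hK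
  refine ⟨2 * C, hC.weaken (le_mul_of_one_le_left bot_le one_le_two), fun a ha b hb => ?_⟩
  have hseg : segment ℝ a b ⊆ K := hKc.segment_subset ha hb
  have hd : ∀ x ∈ segment ℝ a b, HasFDerivWithinAt (fun y => φ y - ⟪gradient φ a, y⟫)
      (fderiv ℝ φ x - innerSL ℝ (gradient φ a)) (segment ℝ a b) x := fun x _ =>
    (((hφ.differentiable (by norm_num)) x).hasFDerivAt.sub
      (innerSL ℝ (gradient φ a)).hasFDerivAt).hasFDerivWithinAt
  have hbd : ∀ x ∈ segment ℝ a b,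
      ‖fderiv ℝ φ x - innerSL ℝ (gradient φ a)‖ ≤ C * ‖b - a‖ := by
    intro x hx
    have e1 : fderiv ℝ φ x - innerSL ℝ (gradient φ a) = innerSL ℝ (gradient φ x - gradient φ a) := by
      ext v
      simp [inner_gradient_left]
    rw [e1, innerSL_apply_norm]
    have e2 := hC.dist_le_mul x (hseg hx) a ha
    rw [dist_eq_norm, dist_eq_norm] at e2
    refine e2.trans ?_
    gcongr
    have e3 := norm_sub_le_of_mem_segment hx
    exact e3
  have := (convex_segment a b).norm_image_sub_le_of_norm_hasFDerivWithin_le hd hbd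
    (left_mem_segment ℝ a b) (right_mem_segment ℝ a b)
  have h2 := (abs_le.1 this).2
  rw [inner_sub_right]
  push_cast
  linarith

end

section Doubling
variable {E : Type*} [NormedAddCommGroup E] [InnerProductSpace ℝ E] [FiniteDimensional ℝ E]

/-- A substitute for the theorem on sums. If `v(z₁) - v(z₂) - φ(z₁, z₂)` takes a value `2 θ`, and all
values above `θ` occur at interior points, then near points `z` with a value above `θ` there are points
`w` at which `v` and `-v` have upper second order expansions, with slopes close to the gradient of `φ`
at `z`. Their Hessians `A₁`, `A₂` satisfy `A₁ + A₂ ≤ 0` in every direction `k` for which `φ` is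
invariant under the translations by `(k, k)`. -/
theorem exists_doubled_expansions {Q : Set E} (hQ : IsCompact Q) (hQc : Convex ℝ Q) {v : E → ℝ}
    (hv : ContinuousOn v Q) {φ : WithLp 2 (E × E) → ℝ} (hφ : ContDiff ℝ 2 φ)
    (hφ0 : ∀ z ∈ l2prod Q Q, 0 ≤ φ z) {θ : ℝ} (hθ : 0 < θ) {z₀ : WithLp 2 (E × E)}
    (hz₀ : z₀ ∈ l2prod Q Q) (hθz₀ : 2 * θ ≤ v z₀.fst - v z₀.snd - φ z₀)
    (hint : ∀ z ∈ l2prod Q Q, θ ≤ v z.fst - v z.snd - φ z → Q ∈ 𝓝 z.fst ∧ Q ∈ 𝓝 z.snd)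
    {r : ℝ} (hr : 0 < r) :
    ∃ C' : ℝ, ∀ δ > 0, ∃ (z w p : WithLp 2 (E × E)) (A₁ A₂ : E →L[ℝ] E),
      z ∈ l2prod Q Q ∧ w ∈ l2prod Q Q ∧ ‖z.fst - w.fst‖ ≤ r ∧ ‖z.snd - w.snd‖ ≤ r ∧
      θ ≤ v z.fst - v z.snd - φ z ∧ θ ≤ v w.fst - v w.snd - φ w ∧
      ‖p‖ ≤ δ ∧ ‖A₁‖ ≤ C' ∧
      (∀ ε > 0, ∀ᶠ k in 𝓝 (0 : E), v (w.fst + k) ≤ v w.fst + ⟪(gradient φ z + p).fst, k⟫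
        + ⟪A₁ k, k⟫ / 2 + ε * ‖k‖ ^ 2) ∧
      (∀ ε > 0, ∀ᶠ k in 𝓝 (0 : E), -v (w.snd + k) ≤ -v w.snd + ⟪(gradient φ z + p).snd, k⟫
        + ⟪A₂ k, k⟫ / 2 + ε * ‖k‖ ^ 2) ∧
      ∀ k, (∀ t : ℝ, φ (z + t • WithLp.toLp 2 (k, k)) = φ z) → ⟪A₁ k, k⟫ + ⟪A₂ k, k⟫ ≤ 0 := by
  have hne : Q.Nonempty := ⟨_, hz₀.1⟩
  set K := l2prod Q Q with hKdef
  have hK : IsCompact K := isCompact_l2prod hQ hQ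
  have hKc : Convex ℝ K := convex_l2prod hQc hQc
  -- a scale on which `v` and `φ` oscillate little
  obtain ⟨r₁, hr₁, hvr⟩ := Metric.uniformContinuousOn_iff_le.1
    (hQ.uniformContinuousOn_of_continuous hv) (θ / 4) (by positivity)
  obtain ⟨r₂, hr₂, hφr⟩ := Metric.uniformContinuousOn_iff_le.1
    (hK.uniformContinuousOn_of_continuous hφ.continuous.continuousOn) (θ / 2) (by positivity)
  set ρ := min r (min r₁ (r₂ / 2)) with hρ
  have hρ0 : 0 < ρ := by positivity
  obtain ⟨B, hB⟩ := hQ.exists_bound_of_continuousOn hv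
  have hB0 : 0 ≤ B := (norm_nonneg _).trans (hB _ hz₀.1)
  set ε := ρ ^ 2 / (2 * (2 * B + 1)) with hε
  have hε0 : 0 < ε := by positivity
  obtain ⟨U, m₁, hU⟩ := exists_isSupConv hQ hne hv ε
  obtain ⟨W, m₂, hW⟩ := exists_isSupConv hQ hne (v := fun w => -v w) hv.neg ε
  set Ψ : WithLp 2 (E × E) → ℝ := fun z => U z.fst + W z.snd with hΨ
  -- points with a large value of the regularized function
  have hlarge : ∀ z ∈ K, 3 / 2 * θ ≤ Ψ z - φ z →
      ‖z.fst - m₁ z.fst‖ ≤ ρ ∧ ‖z.snd - m₂ z.snd‖ ≤ ρ ∧ θ ≤ v z.fst - v z.snd - φ z ∧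
      θ ≤ v (m₁ z.fst) - v (m₂ z.snd)
        - φ (WithLp.toLp 2 (m₁ z.fst, m₂ z.snd)) := by
    intro z hz h
    have hm₁ := hU.mem z.fst
    have hm₂ := hW.mem z.snd
    have e1 := hU.eq z.fst
    have e2 := hW.eq z.snd
    have b1 := abs_le.1 (hB _ hm₁)
    have b2 := abs_le.1 (hB _ hm₂)
    have hφz := hφ0 z hz
    have p1 : 0 ≤ ‖z.fst - m₁ z.fst‖ ^ 2 / (2 * ε) := by positivity
    have p2 : 0 ≤ ‖z.snd - m₂ z.snd‖ ^ 2 / (2 * ε) := by positivity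
    simp only [hΨ] at h
    have hsq : ∀ a : ℝ, 0 ≤ a → a ^ 2 / (2 * ε) ≤ 2 * B → a ≤ ρ := by
      intro a ha h
      rw [div_le_iff₀ (by positivity)] at h
      have : 2 * B * (2 * ε) ≤ ρ ^ 2 := by
        rw [hε]
        have : 2 * B * (2 * (ρ ^ 2 / (2 * (2 * B + 1)))) = ρ ^ 2 * (2 * B / (2 * B + 1)) := by
          field_simp
        rw [this]
        refine mul_le_of_le_one_right (sq_nonneg _) ?_
        rw [div_le_one (by positivity)]; linarith
      exact le_of_sq_le_sq (h.trans this) hρ0.le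
    have d1 : ‖z.fst - m₁ z.fst‖ ≤ ρ := hsq _ (norm_nonneg _) (by linarith)
    have d2 : ‖z.snd - m₂ z.snd‖ ≤ ρ := hsq _ (norm_nonneg _) (by linarith)
    have v1 := abs_le.1 (hvr _ hz.1 _ hm₁ (by
      rw [dist_eq_norm]; exact d1.trans ((min_le_right _ _).trans (min_le_left _ _))))
    have v2 := abs_le.1 (hvr _ hz.2 _ hm₂ (by
      rw [dist_eq_norm]; exact d2.trans ((min_le_right _ _).trans (min_le_left _ _))))
    have hρ2 : ρ ≤ r₂ / 2 := (min_le_right _ _).trans (min_le_right _ _)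
    have f1 := abs_le.1 (hφr z hz (WithLp.toLp 2 (m₁ z.fst, m₂ z.snd)) ⟨hm₁, hm₂⟩ (by
      rw [dist_eq_norm]
      refine (norm_le_add_l2 _).trans ?_
      have : ‖z.fst - m₁ z.fst‖ + ‖z.snd - m₂ z.snd‖ ≤ r₂ := by linarith
      exact this))
    exact ⟨d1, d2, by linarith, by linarith⟩
  have hz₀large : 2 * θ ≤ Ψ z₀ - φ z₀ := by
    have h1 := hU.le_self hz₀.1
    have h2 := hW.le_self hz₀.2
    simp only [hΨ]
    linarith
  have hmax : ∀ a ∈ K, a ∉ interior K → Ψ a - φ a < Ψ z₀ - φ z₀ := by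
    intro a ha hai
    by_contra! hcon
    obtain ⟨-, -, h1, -⟩ := hlarge a ha (by linarith)
    obtain ⟨h2, h3⟩ := hint a ha h1
    exact hai (mem_interior_iff_mem_nhds.2 (l2prod_mem_nhds h2 h3))
  obtain ⟨C, hC, hCφ⟩ := hφ.exists_gradient_lipschitzOnWith hK hKc
  have hΨc : Continuous Ψ :=
    ((hU.continuous hε0 hQ).comp (WithLp.continuous_fst 2 E E)).add
      ((hW.continuous hε0 hQ).comp (WithLp.continuous_snd 2 E E))
  obtain ⟨lam, hlam⟩ : ∃ lam : ℝ≥0, (lam : ℝ) = ε⁻¹ := ⟨⟨ε⁻¹, inv_nonneg.2 hε0.le⟩, rfl⟩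
  have hsemi : ∀ a ∈ K, ∃ q, ∀ b ∈ K, Ψ a + ⟪q, b - a⟫ - lam / 2 * ‖b - a‖ ^ 2 ≤ Ψ b := by
    intro a _
    refine ⟨WithLp.toLp 2 (ε⁻¹ • (m₁ a.fst - a.fst), ε⁻¹ • (m₂ a.snd - a.snd)), fun b _ => ?_⟩
    have h1 := hU.semiconvex hε0 a.fst b.fst
    have h2 := hW.semiconvex hε0 a.snd b.snd
    rw [WithLp.prod_inner_apply, WithLp.prod_norm_sq_eq_of_L2]
    simp only [WithLp.sub_fst, WithLp.sub_snd, WithLp.ofLp_sub, Prod.fst_sub, Prod.snd_sub]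
    simp only [hΨ, hlam, WithLp.ofLp_fst, WithLp.ofLp_snd]
    linarith
  obtain ⟨C', hC'⟩ := exists_contact_second_order hK hΨc.continuousOn
    hφ.continuous.continuousOn hsemi hC hCφ hz₀ hmax
  obtain ⟨D, hD⟩ := hK.isBounded.exists_norm_le
  have hD0 : 0 ≤ D := (norm_nonneg _).trans (hD _ hz₀)
  refine ⟨C', fun δ hδ => ?_⟩
  obtain ⟨z, hzi, p, A, hp, hA, hcontact, hexp⟩ := hC' (min δ (θ / (4 * (D + 1)))) (by positivity)
  have hz : z ∈ K := interior_subset hzi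
  have hzlarge : 3 / 2 * θ ≤ Ψ z - φ z := by
    have h1 := hcontact z₀ hz₀
    have h2 : ⟪p, z₀ - z⟫ ≤ θ / 2 := by
      calc ⟪p, z₀ - z⟫ ≤ ‖p‖ * ‖z₀ - z‖ := real_inner_le_norm _ _
        _ ≤ (θ / (4 * (D + 1))) * (D + D) := by
          gcongr
          · exact hp.trans (min_le_right _ _)
          · exact (norm_sub_le _ _).trans (add_le_add (hD _ hz₀) (hD _ hz))
        _ ≤ θ / 2 := by
          rw [div_mul_eq_mul_div, div_le_div_iff₀ (by positivity) (by norm_num)]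
          nlinarith
    linarith
  obtain ⟨d1, d2, h1, h2⟩ := hlarge z hz hzlarge
  have hwK : WithLp.toLp 2 (m₁ z.fst, m₂ z.snd) ∈ K := ⟨hU.mem _, hW.mem _⟩
  obtain ⟨n1, n2⟩ := hint _ hwK h2
  have hexp' : HasSecondOrderAt (fun y : WithLp 2 (E × E) => U y.fst + W y.snd)
    (gradient φ z + p) A z := hexp
  refine ⟨z, WithLp.toLp 2 (m₁ z.fst, m₂ z.snd), p, blockFst A, blockSnd A, hz, hwK,
    d1.trans (min_le_left _ _), d2.trans (min_le_left _ _), h1, h2, hp.trans (min_le_left _ _),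
    (norm_blockFst_le A).trans hA, fun ε' hε' => hU.expansion_le hexp'.fst n1 hε',
    fun ε' hε' => hW.expansion_le hexp'.snd n2 hε', fun k hk => ?_⟩
  refine inner_add_inner_nonpos_of_second_order hexp'.fst hexp'.snd ?_
  set kk : WithLp 2 (E × E) := WithLp.toLp 2 (k, k) with hkk
  have hgrad : ⟪gradient φ z, kk⟫ = 0 := by
    have hc : HasDerivAt (fun t : ℝ => φ (z + t • kk)) 0 0 := by
      rw [show (fun t : ℝ => φ (z + t • kk)) = fun _ => φ z from funext hk]
      exact hasDerivAt_const _ _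
    exact (hasDerivAt_comp_line (hφ.differentiable (by norm_num) z) kk).unique hc
  have ht : Tendsto (fun t : ℝ => z + t • kk) (𝓝 0) (𝓝 z) := by
    have : Continuous fun t : ℝ => z + t • kk := by fun_prop
    simpa using this.tendsto 0
  filter_upwards [ht (mem_interior_iff_mem_nhds.1 hzi)] with t htK
  have e1 := hcontact _ htK
  rw [hk t, add_sub_cancel_left, real_inner_smul_right] at e1
  have e2 : ⟪(gradient φ z + p).fst + (gradient φ z + p).snd, k⟫ = ⟪p, kk⟫ := by
    have : ⟪(gradient φ z + p).fst + (gradient φ z + p).snd, k⟫ = ⟪gradient φ z + p, kk⟫ := by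
      rw [WithLp.prod_inner_apply, inner_add_left]
      rfl
    rw [this, inner_add_left, hgrad, zero_add]
  have e3 : Ψ (z + t • kk) = U (z.fst + t • k) + W (z.snd + t • k) := rfl
  have e4 : Ψ z = U z.fst + W z.snd := rfl
  rw [e3, e4] at e1
  rw [e2]
  linarith

end Doubling

/-! ### The penalty function -/

section Penalty

variable {n : ℕ}

/-- Pairs of points of space-time. -/
abbrev SpaceTimePair (n : ℕ) : Type := WithLp 2 (SpaceTime n × SpaceTime n)

/-- The penalty function
`L e^{Mt} √(|x - y|² + κ²) + S e^{N(t - T')} + S e^{N(s - T')} + R (t - s)²`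
at the pair `((x, t), (y, s))`. -/
def penalty (L M κ S N T' R : ℝ) (z : SpaceTimePair n) : ℝ :=
  L * Real.exp (M * z.fst.snd) * √(‖z.fst.fst - z.snd.fst‖ ^ 2 + κ ^ 2)
    + S * Real.exp (N * (z.fst.snd - T')) + S * Real.exp (N * (z.snd.snd - T'))
    + R * (z.fst.snd - z.snd.snd) ^ 2

variable {L M κ S N T' R : ℝ}

lemma contDiff_penalty (hκ : 0 < κ) : ContDiff ℝ 2 (penalty (n := n) L M κ S N T' R) := by
  have h1 : ContDiff ℝ 2 (fun z : SpaceTimePair n => z.fst.snd) :=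
    ((WithLp.sndL 2 ℝ (Eucl n) ℝ).comp (WithLp.fstL 2 ℝ (SpaceTime n) (SpaceTime n))).contDiff
  have h2 : ContDiff ℝ 2 (fun z : SpaceTimePair n => z.snd.snd) :=
    ((WithLp.sndL 2 ℝ (Eucl n) ℝ).comp (WithLp.sndL 2 ℝ (SpaceTime n) (SpaceTime n))).contDiff
  have h3 : ContDiff ℝ 2 (fun z : SpaceTimePair n => z.fst.fst) :=
    ((WithLp.fstL 2 ℝ (Eucl n) ℝ).comp (WithLp.fstL 2 ℝ (SpaceTime n) (SpaceTime n))).contDiff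
  have h4 : ContDiff ℝ 2 (fun z : SpaceTimePair n => z.snd.fst) :=
    ((WithLp.fstL 2 ℝ (Eucl n) ℝ).comp (WithLp.sndL 2 ℝ (SpaceTime n) (SpaceTime n))).contDiff
  have h5 : ContDiff ℝ 2
      (fun z : SpaceTimePair n => √(‖z.fst.fst - z.snd.fst‖ ^ 2 + κ ^ 2)) :=
    (((h3.sub h4).norm_sq ℝ).add contDiff_const).sqrt fun z => by positivity
  exact ((((contDiff_const.mul (contDiff_const.mul h1).exp).mul h5).add
    (contDiff_const.mul (contDiff_const.mul (h1.sub contDiff_const)).exp)).add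
    (contDiff_const.mul (contDiff_const.mul (h2.sub contDiff_const)).exp)).add
    (contDiff_const.mul ((h1.sub h2).pow 2))

lemma inner_gradient_penalty (hκ : 0 < κ) (z h : SpaceTimePair n) :
    ⟪gradient (penalty (n := n) L M κ S N T' R) z, h⟫
      = L * Real.exp (M * z.fst.snd) * (M * h.fst.snd * √(‖z.fst.fst - z.snd.fst‖ ^ 2 + κ ^ 2)
          + ⟪z.fst.fst - z.snd.fst, h.fst.fst - h.snd.fst⟫
            / √(‖z.fst.fst - z.snd.fst‖ ^ 2 + κ ^ 2))
        + S * Real.exp (N * (z.fst.snd - T')) * (N * h.fst.snd)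
        + S * Real.exp (N * (z.snd.snd - T')) * (N * h.snd.snd)
        + R * (2 * (z.fst.snd - z.snd.snd) * (h.fst.snd - h.snd.snd)) := by
  have hd' := hasDerivAt_comp_line
    ((contDiff_penalty (n := n) (L := L) (M := M) (S := S) (N := N) (T' := T') (R := R)
      hκ).differentiable (by norm_num) z) h
  have k1 : HasDerivAt (fun r : ℝ => z.fst.snd + r * h.fst.snd) h.fst.snd 0 := by
    simpa using ((hasDerivAt_id (0 : ℝ)).mul_const h.fst.snd).const_add z.fst.snd
  have k2 : HasDerivAt (fun r : ℝ => z.snd.snd + r * h.snd.snd) h.snd.snd 0 := by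
    simpa using ((hasDerivAt_id (0 : ℝ)).mul_const h.snd.snd).const_add z.snd.snd
  set a := z.fst.fst - z.snd.fst with ha
  set b := h.fst.fst - h.snd.fst with hb
  have k3 : HasDerivAt (fun r : ℝ => a + r • b) b 0 := by
    simpa using ((hasDerivAt_id (0 : ℝ)).smul_const b).const_add a
  have k4 : HasDerivAt (fun r : ℝ => ‖a + r • b‖ ^ 2 + κ ^ 2) (2 * ⟪a, b⟫) 0 := by
    simpa using k3.norm_sq.add_const (κ ^ 2)
  have hpos : 0 < ‖a + (0 : ℝ) • b‖ ^ 2 + κ ^ 2 := by positivity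
  have k5 := k4.sqrt hpos.ne'
  have k6 := (((((k1.const_mul M).exp.const_mul L).mul k5).add
    (((k1.sub_const T').const_mul N).exp.const_mul S)).add
    (((k2.sub_const T').const_mul N).exp.const_mul S)).add
    (((k1.sub k2).pow 2).const_mul R)
  have heq : (fun r : ℝ => penalty (n := n) L M κ S N T' R (z + r • h)) = fun r =>
      L * Real.exp (M * (z.fst.snd + r * h.fst.snd)) * √(‖a + r • b‖ ^ 2 + κ ^ 2)
        + S * Real.exp (N * (z.fst.snd + r * h.fst.snd - T'))
        + S * Real.exp (N * (z.snd.snd + r * h.snd.snd - T'))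
        + R * (z.fst.snd + r * h.fst.snd - (z.snd.snd + r * h.snd.snd)) ^ 2 := by
    funext r
    have : z.fst.fst + r • h.fst.fst - (z.snd.fst + r • h.snd.fst) = a + r • b := by
      rw [ha, hb, smul_sub]; abel
    simp only [penalty, WithLp.add_fst, WithLp.add_snd, WithLp.smul_fst,
      WithLp.smul_snd, smul_eq_mul, this]
  rw [heq] at hd'
  refine (hd'.unique k6).trans ?_
  have hs : 0 < √(‖a‖ ^ 2 + κ ^ 2) := by positivity
  simp only [zero_mul, add_zero, zero_smul]
  field_simp
  simp
  ring

lemma gradient_penalty_fst_fst (hκ : 0 < κ) (z : SpaceTimePair n) :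
    (gradient (penalty (n := n) L M κ S N T' R) z).fst.fst
      = (L * Real.exp (M * z.fst.snd) / √(‖z.fst.fst - z.snd.fst‖ ^ 2 + κ ^ 2))
        • (z.fst.fst - z.snd.fst) := by
  refine ext_inner_right ℝ fun ξ => ?_
  rw [← inner_l2inl (β := ℝ), ← inner_l2inl (β := SpaceTime n), inner_gradient_penalty hκ]
  simp [real_inner_smul_left]
  ring

lemma gradient_penalty_snd_fst (hκ : 0 < κ) (z : SpaceTimePair n) :
    (gradient (penalty (n := n) L M κ S N T' R) z).snd.fst
      = -((L * Real.exp (M * z.fst.snd) / √(‖z.fst.fst - z.snd.fst‖ ^ 2 + κ ^ 2))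
        • (z.fst.fst - z.snd.fst)) := by
  refine ext_inner_right ℝ fun ξ => ?_
  rw [← inner_l2inl (β := ℝ), ← inner_l2inr (α := SpaceTime n), inner_gradient_penalty hκ]
  simp [real_inner_smul_left]
  ring

lemma gradient_penalty_fst_snd (hκ : 0 < κ) (z : SpaceTimePair n) :
    (gradient (penalty (n := n) L M κ S N T' R) z).fst.snd
      = M * (L * Real.exp (M * z.fst.snd) * √(‖z.fst.fst - z.snd.fst‖ ^ 2 + κ ^ 2))
        + N * (S * Real.exp (N * (z.fst.snd - T'))) + 2 * R * (z.fst.snd - z.snd.snd) := by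
  refine ext_inner_right ℝ fun ξ => ?_
  rw [← inner_l2inr (α := Eucl n), ← inner_l2inl (β := SpaceTime n), inner_gradient_penalty hκ]
  simp
  ring

lemma gradient_penalty_snd_snd (hκ : 0 < κ) (z : SpaceTimePair n) :
    (gradient (penalty (n := n) L M κ S N T' R) z).snd.snd
      = N * (S * Real.exp (N * (z.snd.snd - T'))) - 2 * R * (z.fst.snd - z.snd.snd) := by
  refine ext_inner_right ℝ fun ξ => ?_
  rw [← inner_l2inr (α := Eucl n), ← inner_l2inr (α := SpaceTime n), inner_gradient_penalty hκ]
  simp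
  ring

lemma penalty_add_diag (z : SpaceTimePair n) (ξ : Eucl n) (r : ℝ) :
    penalty L M κ S N T' R (z + r • WithLp.toLp 2 (l2inl (Eucl n) ℝ ξ, l2inl (Eucl n) ℝ ξ))
      = penalty L M κ S N T' R z := by
  simp [penalty]

lemma le_sqrt_norm_sq_add (a : Eucl n) (κ : ℝ) : ‖a‖ ≤ √(‖a‖ ^ 2 + κ ^ 2) :=
  Real.le_sqrt_of_sq_le (by nlinarith [sq_nonneg κ])

lemma sqrt_norm_sq_add_le (a : Eucl n) (hκ : 0 ≤ κ) : √(‖a‖ ^ 2 + κ ^ 2) ≤ ‖a‖ + κ :=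
  Real.sqrt_le_iff.2 ⟨by positivity, by nlinarith [norm_nonneg a, mul_nonneg (norm_nonneg a) hκ]⟩

/-- The four terms of the penalty are nonnegative, so each of them is a lower bound. -/
lemma penalty_lower_bounds (hL : 0 ≤ L) (hM : 0 ≤ M) (hS : 0 ≤ S) (hR : 0 ≤ R)
    {z : SpaceTimePair n} (ht : 0 ≤ z.fst.snd) :
    L * ‖z.fst.fst - z.snd.fst‖ ≤ penalty L M κ S N T' R z ∧
    S * Real.exp (N * (z.fst.snd - T')) ≤ penalty L M κ S N T' R z ∧
    S * Real.exp (N * (z.snd.snd - T')) ≤ penalty L M κ S N T' R z ∧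
    R * (z.fst.snd - z.snd.snd) ^ 2 ≤ penalty L M κ S N T' R z := by
  have h1 : L * ‖z.fst.fst - z.snd.fst‖
      ≤ L * Real.exp (M * z.fst.snd) * √(‖z.fst.fst - z.snd.fst‖ ^ 2 + κ ^ 2) := by
    have e1 : 1 ≤ Real.exp (M * z.fst.snd) := Real.one_le_exp (by positivity)
    calc L * ‖z.fst.fst - z.snd.fst‖ = L * 1 * ‖z.fst.fst - z.snd.fst‖ := by ring
      _ ≤ _ := by
        gcongr
        exact le_sqrt_norm_sq_add _ _
  have h0 : 0 ≤ L * ‖z.fst.fst - z.snd.fst‖ := by positivity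
  have h2 : 0 ≤ S * Real.exp (N * (z.fst.snd - T')) := by positivity
  have h3 : 0 ≤ S * Real.exp (N * (z.snd.snd - T')) := by positivity
  have h4 : 0 ≤ R * (z.fst.snd - z.snd.snd) ^ 2 := by positivity
  unfold penalty
  refine ⟨?_, ?_, ?_, ?_⟩ <;> linarith

end Penalty

section Localization
variable {n : ℕ} {L M κ S N T' R : ℝ}

/-- The compact cylinder `closedBall c ρ × [0, T']` in space-time. -/
abbrev cylinder (c : Eucl n) (ρ T' : ℝ) : Set (SpaceTime n) := l2prod (closedBall c ρ) (Icc 0 T')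

/-- Points where `u(x, t) - u(y, s)` exceeds the penalty by `θ` lie in the interior of the cylinder, have
nearly equal times and spatial components at distance at least `d`. -/
lemma penalized_localization {u : Eucl n → ℝ → ℝ} {c : Eucl n} {ρ ρ₀ S₀ θ d c₀ : ℝ}
    (hL : 0 ≤ L) (hM : 0 ≤ M) (hR : 0 ≤ R) (hθ : 0 < θ) (hd : 0 ≤ d) (hS₀ : 0 ≤ S₀)
    (hosc : ∀ w ∈ cylinder c ρ T', ∀ w' ∈ cylinder c ρ T', u w.fst w.snd - u w'.fst w'.snd ≤ S₀)
    (hS : S₀ < S)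
    (hmod : ∀ w ∈ cylinder c ρ T', ∀ w' ∈ cylinder c ρ T', dist w w' ≤ d →
      dist (u w.fst w.snd) (u w'.fst w'.snd) ≤ θ / 3)
    (hinit : ∀ x y, u x 0 - u y 0 ≤ L * ‖x - y‖)
    (hconst : ∀ x ∉ ball c ρ₀, ∀ t ∈ Icc 0 T', u x t = c₀) (hρ : ρ₀ < ρ) (hρS : S₀ ≤ L * (ρ - ρ₀))
    (hRd : S₀ ≤ R * d ^ 2) {z : SpaceTimePair n}
    (hz : z ∈ l2prod (cylinder c ρ T') (cylinder c ρ T'))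
    (h : θ ≤ u z.fst.fst z.fst.snd - u z.snd.fst z.snd.snd - penalty L M κ S N T' R z) :
    z.fst.fst ∈ ball c ρ ∧ z.snd.fst ∈ ball c ρ ∧ z.fst.snd ∈ Ioo 0 T' ∧ z.snd.snd ∈ Ioo 0 T' ∧
      d ≤ ‖z.fst.fst - z.snd.fst‖ ∧ |z.fst.snd - z.snd.snd| ≤ d := by
  obtain ⟨x, t, hzx⟩ : ∃ x t, z.fst = WithLp.toLp 2 (x, t) := ⟨z.fst.fst, z.fst.snd, rfl⟩
  obtain ⟨y, s, hzy⟩ : ∃ y s, z.snd = WithLp.toLp 2 (y, s) := ⟨z.snd.fst, z.snd.snd, rfl⟩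
  obtain ⟨p1, p2, p3, p4⟩ := penalty_lower_bounds (κ := κ) (N := N) (T' := T') hL hM
    (hS₀.trans hS.le) hR (z := z) hz.1.2.1
  obtain ⟨hz1, hz2⟩ := hz
  have ho := hosc _ hz1 _ hz2
  generalize penalty L M κ S N T' R z = P at *
  rw [hzx] at *
  rw [hzy] at *
  simp only [WithLp.toLp_fst, WithLp.toLp_snd] at *
  obtain ⟨hx, ht⟩ := hz1
  obtain ⟨hy, hs⟩ := hz2
  simp only [WithLp.toLp_fst, WithLp.toLp_snd] at hx ht hy hs
  have hP0 : 0 ≤ P := le_trans (by positivity) p1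
  have hPS : P < S₀ := by linarith
  have hts : |t - s| ≤ d := by
    by_contra! hcon
    have h1 : d ^ 2 ≤ (t - s) ^ 2 := by
      rw [← sq_abs (t - s)]
      gcongr
    have h2 : R * d ^ 2 ≤ R * (t - s) ^ 2 := by gcongr
    linarith
  have htime : ∀ a ∈ closedBall c ρ, |u a t - u a s| ≤ θ / 3 := by
    intro a ha
    refine hmod (WithLp.toLp 2 (a, t)) ⟨ha, ht⟩ (WithLp.toLp 2 (a, s)) ⟨ha, hs⟩ ?_
    rw [dist_eq_norm]
    refine (norm_le_add_l2 _).trans ?_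
    simpa using hts
  have hty := abs_le.1 (htime y hy)
  have htx := abs_le.1 (htime x hx)
  have hLxy : 0 ≤ L * ‖x - y‖ := by positivity
  have hfar : ∀ a b : Eucl n, a ∉ ball c ρ → b ∈ ball c ρ₀ → S₀ ≤ L * ‖a - b‖ := by
    intro a b ha hb
    refine hρS.trans ?_
    gcongr
    rw [mem_ball, not_lt] at ha
    rw [mem_ball] at hb
    have := dist_triangle a b c
    rw [dist_eq_norm a b] at this
    linarith
  have hsub : ball c ρ₀ ⊆ ball c ρ := ball_subset_ball hρ.le
  refine ⟨?_, ?_, ⟨ht.1.lt_of_ne ?_, ht.2.lt_of_ne ?_⟩, ⟨hs.1.lt_of_ne ?_, hs.2.lt_of_ne ?_⟩, ?_, hts⟩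
  · by_contra hx'
    have h1 := hconst x (fun h => hx' (hsub h)) t ht
    by_cases hy' : y ∈ ball c ρ₀
    · linarith [hfar x y hx' hy']
    · linarith [hconst y hy' s hs]
  · by_contra hy'
    have h1 := hconst y (fun h => hy' (hsub h)) s hs
    by_cases hx' : x ∈ ball c ρ₀
    · have := hfar y x hy' hx'
      rw [norm_sub_rev] at this
      linarith
    · linarith [hconst x hx' t ht]
  · rintro rfl
    linarith [hinit x y]
  · rintro rfl
    rw [sub_self, mul_zero, Real.exp_zero] at p2
    linarith
  · rintro rfl
    linarith [hinit x y]
  · rintro rfl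
    rw [sub_self, mul_zero, Real.exp_zero] at p3
    linarith
  · by_contra! hcon
    have h1 : dist (u x t) (u y t) ≤ θ / 3 :=
      hmod (WithLp.toLp 2 (x, t)) ⟨hx, ht⟩ (WithLp.toLp 2 (y, t)) ⟨hy, ht⟩ (by
        rw [dist_eq_norm]
        refine (norm_le_add_l2 _).trans ?_
        simpa using hcon.le)
    have h2 := (abs_le.1 h1).2
    linarith

end Localization

/-! ### The Lipschitz estimate -/

section Main
variable {n : ℕ} {σ : Eucl n → ℝ} {g f u : Eucl n → ℝ → ℝ} {T : ℝ}

lemma exists_abs_le_of_eventually_const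
    (hu : ContinuousOn (fun z : Eucl n × ℝ => u z.1 z.2) (univ ×ˢ Icc (0 : ℝ) T)) {c : Eucl n}
    {ρ c₀ : ℝ} (hconst : ∀ x ∉ ball c ρ, ∀ t ∈ Icc (0 : ℝ) T, u x t = c₀) :
    ∃ B, ∀ x, ∀ t ∈ Icc (0 : ℝ) T, |u x t| ≤ B := by
  have hK : IsCompact (closedBall c ρ ×ˢ Icc (0 : ℝ) T) := (isCompact_closedBall c ρ).prod isCompact_Icc
  obtain ⟨B, hB⟩ := hK.exists_bound_of_continuousOn
    (hu.mono (prod_mono (subset_univ _) subset_rfl))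
  refine ⟨max B |c₀|, fun x t ht => ?_⟩
  by_cases hx : x ∈ ball c ρ
  · exact (hB (x, t) ⟨ball_subset_closedBall hx, ht⟩).trans (le_max_left _ _)
  · rw [hconst x hx t ht]
    exact le_max_right _ _

/-- The difference of the two viscosity inequalities, for jets with ordered Hessians. -/
lemma jets_slope_sub_le {Lg : ℝ≥0} (hσ : ContDiffOn ℝ 2 σ {0}ᶜ) (hconv : ConvexOn ℝ univ σ)
    (hg : ContinuousOn (fun q : Eucl n × ℝ => g q.1 q.2) (sphere 0 1 ×ˢ univ))
    (hg_lip : ∀ ν ∈ sphere (0 : Eucl n) 1, LipschitzWith Lg (g ν))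
    (hg_mono : ∀ ν ∈ sphere (0 : Eucl n) 1, Monotone (g ν))
    (hf : ContinuousOn (fun z : Eucl n × ℝ => f z.1 z.2) (univ ×ˢ Icc (0 : ℝ) T))
    (hu : IsViscSol σ g f T u) {x y : Eucl n} {t s τ₁ τ₂ : ℝ} {p₁ p₂ : Eucl n} {X Y : Endo n}
    (ht : t ∈ Ioo (0 : ℝ) T) (hs : s ∈ Ioo (0 : ℝ) T) (hp₁ : p₁ ≠ 0) (hp₂ : p₂ ≠ 0)
    (hX : IsSuperjet u x t τ₁ p₁ X) (hY : IsSubjet u y s τ₂ p₂ Y)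
    (hXY : ∀ v, ⟪X v, v⟫ ≤ ⟪Y v, v⟫) :
    τ₁ - τ₂ ≤ frozenOp σ g (p₂, X, f y s) - frozenOp σ g (p₁, X, f y s)
      + ‖p₁‖ * (Lg * |f y s - f x t|) := by
  have h1 := hu.sub.add_frozenOp_le hσ hg hf ht hp₁ hX
  have h2 := hu.super.add_frozenOp_nonneg hσ hg hf hs hp₂ hY
  have h3 := frozenOp_mono hσ hconv hg_mono hp₂ hXY (f y s)
  have h4 := frozenOp_sub_le (σ := σ) hg_lip hp₁ X (f y s) (f x t)
  linarith

lemma exists_uniform_modulus_frozenOp (hσ : ContDiffOn ℝ 2 σ {0}ᶜ)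
    (hg : ContinuousOn (fun q : Eucl n × ℝ => g q.1 q.2) (sphere 0 1 ×ˢ univ)) {a b C B ε : ℝ}
    (ha : 0 < a) (hε : 0 < ε) :
    ∃ δ > 0, ∀ p₁ p₂ : Eucl n, ∀ X : Endo n, ∀ r : ℝ, a ≤ ‖p₁‖ → ‖p₁‖ ≤ b → a ≤ ‖p₂‖ → ‖p₂‖ ≤ b →
      ‖X‖ ≤ C → |r| ≤ B → ‖p₂ - p₁‖ ≤ δ → frozenOp σ g (p₂, X, r) - frozenOp σ g (p₁, X, r) ≤ ε := by
  set P : Set (Eucl n) := closedBall 0 b \ ball 0 a with hP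
  have hPc : IsCompact P := (isCompact_closedBall 0 b).diff isOpen_ball
  have hmem : ∀ p : Eucl n, a ≤ ‖p‖ → ‖p‖ ≤ b → p ∈ P := fun p h1 h2 => by
    simp [hP, h1, h2]
  have hK : IsCompact (P ×ˢ (closedBall (0 : Endo n) C ×ˢ closedBall (0 : ℝ) B)) :=
    hPc.prod ((isCompact_closedBall _ _).prod (isCompact_closedBall _ _))
  have hsub : P ×ˢ (closedBall (0 : Endo n) C ×ˢ closedBall (0 : ℝ) B) ⊆ {q | q.1 ≠ 0} := by
    rintro ⟨p, X, r⟩ ⟨hp, -⟩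
    change p ≠ 0
    rintro rfl
    exact hp.2 (mem_ball_self ha)
  obtain ⟨δ, hδ, h⟩ := Metric.uniformContinuousOn_iff_le.1
    (hK.uniformContinuousOn_of_continuous ((continuousOn_frozenOp hσ hg).mono hsub)) ε hε
  refine ⟨δ, hδ, fun p₁ p₂ X r h1 h2 h3 h4 hX hr hd => ?_⟩
  have hXr : (X, r) ∈ closedBall (0 : Endo n) C ×ˢ closedBall (0 : ℝ) B := by
    simp [hX, hr]
  have := h (p₂, X, r) ⟨hmem p₂ h3 h4, hXr⟩ (p₁, X, r) ⟨hmem p₁ h1 h2, hXr⟩ (by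
    rw [Prod.dist_eq, dist_self, dist_eq_norm]
    exact max_le hd hδ.le)
  exact (abs_le.1 this).2

lemma continuousOn_cylinder {k : Eucl n → ℝ → ℝ} {c : Eucl n} {ρ T' : ℝ}
    (hk : ContinuousOn (fun z : Eucl n × ℝ => k z.1 z.2) (univ ×ˢ Icc (0 : ℝ) T))
    (hT' : Icc 0 T' ⊆ Icc 0 T) :
    ContinuousOn (fun w : SpaceTime n => k w.fst w.snd) (cylinder c ρ T') :=
  hk.comp (f := fun w : SpaceTime n => (w.fst, w.snd))
    (WithLp.prod_continuous_ofLp 2 (Eucl n) ℝ).continuousOn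
    fun _ hw => ⟨mem_univ _, hT' hw.2⟩

/-- The core of the doubling argument: with `M = L_g L_f`, and with large values of the penalized
difference confined as in `penalized_localization`, no value reaches `2 θ`. The number `e₁` bounds the
oscillation of `f` in time at the scale `d` and has to be small compared with the gain
`N S e^{-N T'}` from the exponential barriers. -/
theorem penalized_difference_lt {Lg Lf : ℝ≥0}
    (hσ : ContDiffOn ℝ 2 σ {0}ᶜ) (hconv : ConvexOn ℝ univ σ)
    (hg : ContinuousOn (fun q : Eucl n × ℝ => g q.1 q.2) (sphere 0 1 ×ˢ univ))
    (hg_lip : ∀ ν ∈ sphere (0 : Eucl n) 1, LipschitzWith Lg (g ν))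
    (hg_mono : ∀ ν ∈ sphere (0 : Eucl n) 1, Monotone (g ν))
    (hf : ContinuousOn (fun z : Eucl n × ℝ => f z.1 z.2) (univ ×ˢ Icc (0 : ℝ) T))
    (hf_lip : ∀ t ∈ Icc (0 : ℝ) T, LipschitzWith Lf (fun x => f x t))
    (hu : IsViscSol σ g f T u) {c : Eucl n} {L M κ S N T' R ρ θ d e₁ : ℝ}
    (hL : 0 < L) (hMdef : M = Lg * Lf) (hκ : 0 < κ) (hN : 0 < N) (hSpos : 0 < S) (hR : 0 ≤ R)
    (hT'T : T' < T) (hθ : 0 < θ) (hd : 0 < d) (he₁ : 0 < e₁)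
    (he₁b : (L * Real.exp (M * T) + 1) * (Lg * e₁) ≤ N * (S * Real.exp (-(N * T'))) / 8)
    (hmod₂ : ∀ w ∈ cylinder c ρ T', ∀ w' ∈ cylinder c ρ T', dist w w' ≤ d →
      dist (f w.fst w.snd) (f w'.fst w'.snd) ≤ e₁)
    (hloc : ∀ z ∈ l2prod (cylinder c ρ T') (cylinder c ρ T'),
      θ ≤ u z.fst.fst z.fst.snd - u z.snd.fst z.snd.snd - penalty L M κ S N T' R z →
      z.fst.fst ∈ ball c ρ ∧ z.snd.fst ∈ ball c ρ ∧ z.fst.snd ∈ Ioo 0 T' ∧ z.snd.snd ∈ Ioo 0 T' ∧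
        d ≤ ‖z.fst.fst - z.snd.fst‖ ∧ |z.fst.snd - z.snd.snd| ≤ d)
    {z₀ : SpaceTimePair n} (hz₀ : z₀ ∈ l2prod (cylinder c ρ T') (cylinder c ρ T')) :
    u z₀.fst.fst z₀.fst.snd - u z₀.snd.fst z₀.snd.snd - penalty L M κ S N T' R z₀ < 2 * θ := by
  by_contra! hz₀val
  have hM : 0 ≤ M := by rw [hMdef]; positivity
  have hIcc : Icc 0 T' ⊆ Icc 0 T := Icc_subset_Icc_right hT'T.le
  set Q : Set (SpaceTime n) := cylinder c ρ T' with hQdef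
  have hQ : IsCompact Q := isCompact_l2prod (isCompact_closedBall c ρ) isCompact_Icc
  have hQc : Convex ℝ Q := convex_l2prod (convex_closedBall c ρ) (convex_Icc 0 T')
  have hv := continuousOn_cylinder (c := c) (ρ := ρ) hu.cont hIcc
  have hfQ := continuousOn_cylinder (c := c) (ρ := ρ) hf hIcc
  obtain ⟨Λ, hΛdef⟩ : ∃ Λ : ℝ, Λ = L * Real.exp (M * T) := ⟨_, rfl⟩
  have hΛ : 0 < Λ := by rw [hΛdef]; positivity
  obtain ⟨b, hbdef⟩ : ∃ b : ℝ, b = N * (S * Real.exp (-(N * T'))) := ⟨_, rfl⟩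
  have hb : 0 < b := by rw [hbdef]; positivity
  rw [← hΛdef, ← hbdef] at he₁b
  obtain ⟨r, hr, hrb⟩ : ∃ r > 0, (Λ + 1) * (Lg * (Lf * (2 * r))) ≤ b / 8 := by
    refine ⟨b / 16 / ((Λ + 1) * (Lg * Lf + 1)), by positivity, ?_⟩
    have : (Λ + 1) * (Lg * (Lf * (2 * (b / 16 / ((Λ + 1) * (Lg * Lf + 1))))))
        = b / 8 * (Lg * Lf / (Lg * Lf + 1)) := by
      field_simp
      ring
    rw [this]
    refine mul_le_of_le_one_right (by positivity) ?_
    rw [div_le_one (by positivity)]; linarith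
  set φ : SpaceTimePair n → ℝ := penalty L M κ S N T' R with hφ
  obtain ⟨C', hC'⟩ := exists_doubled_expansions hQ hQc hv (φ := φ) (contDiff_penalty hκ)
    (fun z hz => (mul_nonneg hL.le (norm_nonneg _)).trans
      (penalty_lower_bounds hL.le hM hSpos.le hR hz.1.2.1).1) hθ
    hz₀ hz₀val
    (fun z hz h => by
      obtain ⟨h1, h2, h3, h4, -, -⟩ := hloc z hz h
      exact ⟨l2prod_mem_nhds (closedBall_mem_nhds_of_mem h1) (Icc_mem_nhds h3.1 h3.2),
        l2prod_mem_nhds (closedBall_mem_nhds_of_mem h2) (Icc_mem_nhds h4.1 h4.2)⟩) hr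
  obtain ⟨Bf, hBf⟩ := hQ.exists_bound_of_continuousOn hfQ
  -- bounds for the slopes
  obtain ⟨D, hD, hDρ⟩ : ∃ D > 0, 2 * ρ ≤ D :=
    ⟨2 * |ρ| + 1, by positivity, by linarith [le_abs_self ρ]⟩
  obtain ⟨a₁, ha₁def⟩ : ∃ a₁ : ℝ, a₁ = L * d / (D + κ) / 2 := ⟨_, rfl⟩
  have ha₁ : 0 < a₁ := by rw [ha₁def]; positivity
  obtain ⟨δ₀, hδ₀, hunif⟩ := exists_uniform_modulus_frozenOp hσ hg (a := a₁) (b := Λ + 1) (C := C')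
    (B := Bf) (ε := b / 8) ha₁ (by positivity)
  obtain ⟨δ, hδ, hδ₁, hδ₂, hδ₃, hδ₄, hδ₅⟩ : ∃ δ > 0, δ ≤ b / 16 ∧ δ * (Lg * (Lf * D)) ≤ b / 8 ∧
      δ ≤ a₁ ∧ δ ≤ 1 ∧ 2 * δ ≤ δ₀ := by
    refine ⟨min (min (b / 16) (b / 8 / (Lg * (Lf * D) + 1))) (min (min a₁ 1) (δ₀ / 2)),
      by positivity, (min_le_left _ _).trans (min_le_left _ _), ?_,
      (min_le_right _ _).trans ((min_le_left _ _).trans (min_le_left _ _)),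
      (min_le_right _ _).trans ((min_le_left _ _).trans (min_le_right _ _)), ?_⟩
    · have h1 : min (min (b / 16) (b / 8 / (Lg * (Lf * D) + 1))) (min (min a₁ 1) (δ₀ / 2))
          ≤ b / 8 / (Lg * (Lf * D) + 1) := (min_le_left _ _).trans (min_le_right _ _)
      have h2 : (0 : ℝ) ≤ Lg * (Lf * D) := by positivity
      refine (mul_le_mul_of_nonneg_right h1 h2).trans ?_
      rw [div_mul_eq_mul_div, div_le_iff₀ (by positivity)]
      linarith
    · have : min (min (b / 16) (b / 8 / (Lg * (Lf * D) + 1))) (min (min a₁ 1) (δ₀ / 2)) ≤ δ₀ / 2 :=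
        (min_le_right _ _).trans (min_le_right _ _)
      linarith
  obtain ⟨z, w, p, A₁, A₂, hz, hw, hzw₁, hzw₂, hzθ, hwθ, hp, hA₁, hsup, hsub, hdiag⟩ := hC' δ hδ
  obtain ⟨-, -, hzt, hzs, hzd, -⟩ := hloc z hz hzθ
  obtain ⟨-, -, hwt, hws, -, hwd⟩ := hloc w hw hwθ
  have hjet₁ := isSuperjet_of_expansion A₁ (u := u) (w := w.fst) (q := (gradient φ z + p).fst) hsup
  have hjet₂ := (isSuperjet_of_expansion A₂ (u := fun y s => -u y s) (w := w.snd)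
    (q := (gradient φ z + p).snd) hsub).isSubjet_neg
  have hXY : ∀ v, ⟪spatialHess A₁ v, v⟫ ≤ ⟪(-spatialHess A₂) v, v⟫ := by
    intro v
    have := hdiag (l2inl (Eucl n) ℝ v) (fun r => penalty_add_diag z v r)
    rw [neg_apply, inner_neg_left, inner_spatialHess, inner_spatialHess]
    linarith
  -- the slopes at the two points are small perturbations of the same vector `a`
  set ℓ := ‖z.fst.fst - z.snd.fst‖ with hℓ
  set a : Eucl n := (L * Real.exp (M * z.fst.snd) / √(ℓ ^ 2 + κ ^ 2)) • (z.fst.fst - z.snd.fst) with ha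
  have hs0 : 0 < √(ℓ ^ 2 + κ ^ 2) := by positivity
  have hℓs : ℓ ≤ √(ℓ ^ 2 + κ ^ 2) := le_sqrt_norm_sq_add _ _
  have hℓD : ℓ ≤ D := by
    have h1 := hz.1.1
    have h2 := hz.2.1
    rw [mem_closedBall, dist_eq_norm] at h1 h2
    have := norm_sub_le_norm_sub_add_norm_sub z.fst.fst c z.snd.fst
    rw [norm_sub_rev c] at this
    linarith
  have hsD : √(ℓ ^ 2 + κ ^ 2) ≤ D + κ := (sqrt_norm_sq_add_le _ hκ.le).trans (by linarith)
  have hanorm : ‖a‖ = L * Real.exp (M * z.fst.snd) * (ℓ / √(ℓ ^ 2 + κ ^ 2)) := by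
    rw [ha, norm_smul, Real.norm_of_nonneg (by positivity), ← hℓ]; ring
  have hale : ‖a‖ ≤ L * Real.exp (M * z.fst.snd) := by
    rw [hanorm]
    refine mul_le_of_le_one_right (by positivity) ?_
    rwa [div_le_one hs0]
  have haΛ : ‖a‖ ≤ Λ := by
    refine hale.trans ?_
    rw [hΛdef]
    gcongr
    exact (hzt.2.trans hT'T).le
  have hage : 2 * a₁ ≤ ‖a‖ := by
    rw [hanorm, ha₁def]
    have e1 : 1 ≤ Real.exp (M * z.fst.snd) := Real.one_le_exp (mul_nonneg hM hzt.1.le)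
    calc 2 * (L * d / (D + κ) / 2) = L * 1 * (d / (D + κ)) := by ring
      _ ≤ _ := by gcongr
  have hp₁₁ : ‖p.fst.fst‖ ≤ δ := (WithLp.norm_fst_le _ _).trans ((WithLp.norm_fst_le _ _).trans hp)
  have hp₂₁ : ‖p.snd.fst‖ ≤ δ := (WithLp.norm_fst_le _ _).trans ((WithLp.norm_snd_le _ _).trans hp)
  have hp₁₂ : |p.fst.snd| ≤ δ := (WithLp.norm_snd_le _ _).trans ((WithLp.norm_fst_le _ _).trans hp)
  have hp₂₂ : |p.snd.snd| ≤ δ := (WithLp.norm_snd_le _ _).trans ((WithLp.norm_snd_le _ _).trans hp)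
  have hq₁ : (gradient φ z + p).fst.fst = a + p.fst.fst := by
    rw [WithLp.add_fst, WithLp.add_fst, gradient_penalty_fst_fst hκ]
  have hq₂ : -(gradient φ z + p).snd.fst = a - p.snd.fst := by
    rw [WithLp.add_snd, WithLp.add_fst, gradient_penalty_snd_fst hκ]; abel
  have hτ₁ : (gradient φ z + p).fst.snd = M * (L * Real.exp (M * z.fst.snd) * √(ℓ ^ 2 + κ ^ 2))
        + N * (S * Real.exp (N * (z.fst.snd - T'))) + 2 * R * (z.fst.snd - z.snd.snd)
        + p.fst.snd := by
    rw [WithLp.add_fst, WithLp.add_snd, gradient_penalty_fst_snd hκ]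
  have hτ₂ : (gradient φ z + p).snd.snd = N * (S * Real.exp (N * (z.snd.snd - T')))
        - 2 * R * (z.fst.snd - z.snd.snd) + p.snd.snd := by
    rw [WithLp.add_snd, WithLp.add_snd, gradient_penalty_snd_snd hκ]
  rw [hq₁, hτ₁] at hjet₁
  rw [hq₂, hτ₂] at hjet₂
  have hp₁ge : a₁ ≤ ‖a + p.fst.fst‖ := by
    have := norm_sub_norm_le a (-p.fst.fst)
    rw [norm_neg, sub_neg_eq_add] at this
    linarith
  have hp₁le : ‖a + p.fst.fst‖ ≤ ‖a‖ + δ := (norm_add_le _ _).trans (by linarith)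
  have hp₂ge : a₁ ≤ ‖a - p.snd.fst‖ := by
    have := norm_sub_norm_le a p.snd.fst
    linarith
  have hp₂le : ‖a - p.snd.fst‖ ≤ ‖a‖ + δ := (norm_sub_le _ _).trans (by linarith)
  have hTT : ∀ t ∈ Ioo 0 T', t ∈ Ioo 0 T := fun t ht => ⟨ht.1, ht.2.trans hT'T⟩
  have hmain := jets_slope_sub_le hσ hconv hg hg_lip hg_mono hf hu (hTT _ hwt) (hTT _ hws)
    (norm_pos_iff.1 (ha₁.trans_le hp₁ge)) (norm_pos_iff.1 (ha₁.trans_le hp₂ge)) hjet₁ hjet₂ hXY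
  have hfrozen := hunif (a + p.fst.fst) (a - p.snd.fst) (spatialHess A₁) (f w.snd.fst w.snd.snd)
    hp₁ge (by linarith) hp₂ge (by linarith) ((norm_spatialHess_le A₁).trans hA₁) (hBf _ hw.2) (by
      have : a - p.snd.fst - (a + p.fst.fst) = -(p.snd.fst + p.fst.fst) := by abel
      rw [this, norm_neg]
      exact (norm_add_le _ _).trans (by linarith))
  -- the variation of the forcing term between the two points
  have hfdiff : |f w.snd.fst w.snd.snd - f w.fst.fst w.fst.snd| ≤ Lf * ℓ + Lf * (2 * r) + e₁ := by
    have h1 : |f w.snd.fst w.snd.snd - f w.snd.fst w.fst.snd| ≤ e₁ := by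
      refine hmod₂ w.snd hw.2 (WithLp.toLp 2 (w.snd.fst, w.fst.snd)) ⟨hw.2.1, hw.1.2⟩ ?_
      rw [dist_eq_norm]
      refine (norm_le_add_l2 _).trans ?_
      simp only [WithLp.sub_fst, WithLp.sub_snd, WithLp.toLp_fst, WithLp.toLp_snd, sub_self,
        norm_zero, zero_add]
      rw [Real.norm_eq_abs, abs_sub_comm]
      exact hwd
    have h2 := (hf_lip w.fst.snd (hIcc hw.1.2)).dist_le_mul w.snd.fst w.fst.fst
    rw [Real.dist_eq, dist_eq_norm] at h2
    have h3 : ‖w.snd.fst - w.fst.fst‖ ≤ ℓ + 2 * r := by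
      have e1 : ‖z.fst.fst - w.fst.fst‖ ≤ r := (WithLp.norm_fst_le _ (z.fst - w.fst)).trans hzw₁
      have e2 : ‖z.snd.fst - w.snd.fst‖ ≤ r := (WithLp.norm_fst_le _ (z.snd - w.snd)).trans hzw₂
      have e3 : w.snd.fst - w.fst.fst = -(z.fst.fst - z.snd.fst) + (z.fst.fst - w.fst.fst)
          - (z.snd.fst - w.snd.fst) := by abel
      rw [e3]
      refine (norm_sub_le _ _).trans ?_
      refine (add_le_add_left (norm_add_le _ _) _).trans ?_
      rw [norm_neg]
      linarith
    have h4 : (Lf : ℝ) * ‖w.snd.fst - w.fst.fst‖ ≤ Lf * (ℓ + 2 * r) := by gcongr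
    have h5 := abs_sub_le (f w.snd.fst w.snd.snd) (f w.snd.fst w.fst.snd) (f w.fst.fst w.fst.snd)
    linarith
  have herr : ‖a + p.fst.fst‖ * (Lg * |f w.snd.fst w.snd.snd - f w.fst.fst w.fst.snd|)
      ≤ M * (L * Real.exp (M * z.fst.snd) * √(ℓ ^ 2 + κ ^ 2)) + 3 * (b / 8) := by
    have hℓ0 : 0 ≤ ℓ := norm_nonneg _
    have k1 : ‖a + p.fst.fst‖ * (Lg * (Lf * ℓ)) ≤
        M * (L * Real.exp (M * z.fst.snd) * √(ℓ ^ 2 + κ ^ 2)) + b / 8 := by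
      calc ‖a + p.fst.fst‖ * (Lg * (Lf * ℓ))
          ≤ (L * Real.exp (M * z.fst.snd) + δ) * (Lg * (Lf * ℓ)) := by
            gcongr; linarith
        _ = M * (L * Real.exp (M * z.fst.snd) * ℓ) + δ * (Lg * (Lf * ℓ)) := by rw [hMdef]; ring
        _ ≤ M * (L * Real.exp (M * z.fst.snd) * √(ℓ ^ 2 + κ ^ 2)) + δ * (Lg * (Lf * D)) := by
            gcongr
        _ ≤ _ := by linarith
    have k2 : ‖a + p.fst.fst‖ ≤ Λ + 1 := by linarith
    have k3 : ‖a + p.fst.fst‖ * (Lg * (Lf * (2 * r))) ≤ (Λ + 1) * (Lg * (Lf * (2 * r))) := by gcongr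
    have k4 : ‖a + p.fst.fst‖ * (Lg * e₁) ≤ (Λ + 1) * (Lg * e₁) := by gcongr
    calc ‖a + p.fst.fst‖ * (Lg * |f w.snd.fst w.snd.snd - f w.fst.fst w.fst.snd|)
        ≤ ‖a + p.fst.fst‖ * (Lg * (Lf * ℓ + Lf * (2 * r) + e₁)) := by gcongr
      _ = ‖a + p.fst.fst‖ * (Lg * (Lf * ℓ)) + ‖a + p.fst.fst‖ * (Lg * (Lf * (2 * r)))
          + ‖a + p.fst.fst‖ * (Lg * e₁) := by ring
      _ ≤ _ := by linarith
  -- the strict gain from the exponential barrier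
  have hgain₁ : b ≤ N * (S * Real.exp (N * (z.fst.snd - T'))) := by
    rw [hbdef]
    gcongr
    linarith [mul_nonneg hN.le hzt.1.le]
  have hgain₂ : b ≤ N * (S * Real.exp (N * (z.snd.snd - T'))) := by
    rw [hbdef]
    gcongr
    linarith [mul_nonneg hN.le hzs.1.le]
  have hδp₁ := (abs_le.1 hp₁₂).1
  have hδp₂ := (abs_le.1 hp₂₂).1
  linarith

/-- The estimate at interior times, for any positive Lipschitz constant of the initial data. -/
theorem sub_le_mul_exp_mul_norm_sub {Lg Lf : ℝ≥0}
    (hσ : ContDiffOn ℝ 2 σ {0}ᶜ) (hconv : ConvexOn ℝ univ σ)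
    (hg : ContinuousOn (fun q : Eucl n × ℝ => g q.1 q.2) (sphere 0 1 ×ˢ univ))
    (hg_lip : ∀ ν ∈ sphere (0 : Eucl n) 1, LipschitzWith Lg (g ν))
    (hg_mono : ∀ ν ∈ sphere (0 : Eucl n) 1, Monotone (g ν))
    (hf : ContinuousOn (fun z : Eucl n × ℝ => f z.1 z.2) (univ ×ˢ Icc (0 : ℝ) T))
    (hf_lip : ∀ t ∈ Icc (0 : ℝ) T, LipschitzWith Lf (fun x => f x t))
    (hu : IsViscSol σ g f T u) {c : Eucl n} {ρ₀ c₀ : ℝ}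
    (hconst : ∀ x ∉ ball c ρ₀, ∀ t ∈ Icc (0 : ℝ) T, u x t = c₀)
    {L : ℝ} (hL : 0 < L) (hinit : ∀ x y, u x 0 - u y 0 ≤ L * ‖x - y‖)
    (x₀ y₀ : Eucl n) {t₀ : ℝ} (ht₀ : t₀ ∈ Ioo 0 T) :
    u x₀ t₀ - u y₀ t₀ ≤ L * Real.exp (Lg * Lf * t₀) * ‖x₀ - y₀‖ := by
  by_contra! hcon
  obtain ⟨ht₀0, ht₀T⟩ := ht₀
  obtain ⟨M, hMdef⟩ : ∃ M : ℝ, M = Lg * Lf := ⟨_, rfl⟩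
  rw [← hMdef] at hcon
  have hM : 0 ≤ M := by rw [hMdef]; positivity
  obtain ⟨γ, hγ, hgap⟩ : ∃ γ > 0,
      u x₀ t₀ - u y₀ t₀ = L * Real.exp (M * t₀) * ‖x₀ - y₀‖ + γ := ⟨_, sub_pos.2 hcon, by ring⟩
  -- smoothing parameter of the norm
  obtain ⟨κ, hκ, hκγ⟩ : ∃ κ > 0, L * Real.exp (M * t₀) * κ = γ / 4 :=
    ⟨γ / 4 / (L * Real.exp (M * t₀)), by positivity, by field_simp⟩
  obtain ⟨T', hT'0, hT'T⟩ : ∃ T', t₀ < T' ∧ T' < T := exists_between ht₀T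
  have hIcc : Icc 0 T' ⊆ Icc 0 T := Icc_subset_Icc_right hT'T.le
  -- the oscillation of `u`
  obtain ⟨B, hB⟩ := exists_abs_le_of_eventually_const hu.cont hconst
  have hB0 : 0 ≤ B := (abs_nonneg _).trans (hB x₀ t₀ ⟨ht₀0.le, ht₀T.le⟩)
  obtain ⟨S₀, hS₀def⟩ : ∃ S₀ : ℝ, S₀ = 2 * B := ⟨_, rfl⟩
  have hS₀ : 0 ≤ S₀ := by rw [hS₀def]; positivity
  obtain ⟨S, hSdef⟩ : ∃ S : ℝ, S = S₀ + 1 := ⟨_, rfl⟩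
  have hS : S₀ < S := by linarith
  have hSpos : 0 < S := hS₀.trans_lt hS
  -- the rate of the exponential barrier
  obtain ⟨N, hN, hNγ⟩ : ∃ N > 0, S * Real.exp (N * (t₀ - T')) ≤ γ / 4 := by
    have hT't : 0 < T' - t₀ := sub_pos.2 hT'0
    refine ⟨4 * S / γ / (T' - t₀), by positivity, ?_⟩
    have e1 : 4 * S / γ / (T' - t₀) * (t₀ - T') = -(4 * S / γ) := by
      have : t₀ - T' = -(T' - t₀) := by ring
      rw [this, mul_neg, div_mul_cancel₀ _ hT't.ne']
    rw [e1, Real.exp_neg, ← div_eq_mul_inv, div_le_iff₀ (Real.exp_pos _)]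
    have e2 := Real.add_one_le_exp (4 * S / γ)
    have e3 : γ / 4 * (4 * S / γ) = S := by field_simp
    have e4 := mul_le_mul_of_nonneg_left e2 (show 0 ≤ γ / 4 by positivity)
    linarith
  -- the size of the cylinder
  obtain ⟨ρ, hρ, hρS, hx₀, hy₀⟩ : ∃ ρ, ρ₀ < ρ ∧ S₀ ≤ L * (ρ - ρ₀) ∧ x₀ ∈ closedBall c ρ ∧
      y₀ ∈ closedBall c ρ := by
    have h1 : 0 ≤ S₀ / L := by positivity
    have h2 := dist_nonneg (x := x₀) (y := c)
    have h3 := dist_nonneg (x := y₀) (y := c)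
    have h4 := le_abs_self ρ₀
    have h5 := abs_nonneg ρ₀
    refine ⟨|ρ₀| + S₀ / L + dist x₀ c + dist y₀ c + 1, by linarith, ?_, ?_, ?_⟩
    · have : S₀ = L * (S₀ / L) := by field_simp
      rw [this]
      refine mul_le_mul_of_nonneg_left ?_ hL.le
      rw [← this]; linarith
    · rw [mem_closedBall]; linarith
    · rw [mem_closedBall]; linarith
  set Q : Set (SpaceTime n) := cylinder c ρ T' with hQdef
  have hQ : IsCompact Q := isCompact_l2prod (isCompact_closedBall c ρ) isCompact_Icc
  have hv := continuousOn_cylinder (c := c) (ρ := ρ) hu.cont hIcc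
  have hfQ := continuousOn_cylinder (c := c) (ρ := ρ) hf hIcc
  -- smallness thresholds
  obtain ⟨θ, hθdef⟩ : ∃ θ : ℝ, θ = γ / 8 := ⟨_, rfl⟩
  have hθ : 0 < θ := by rw [hθdef]; positivity
  set Λ := L * Real.exp (M * T) with hΛdef
  have hΛ : 0 < Λ := by positivity
  set b := N * (S * Real.exp (-(N * T'))) with hbdef
  have hb : 0 < b := by positivity
  obtain ⟨e₁, he₁, he₁b⟩ : ∃ e₁ > 0, (Λ + 1) * (Lg * e₁) ≤ b / 8 := by
    refine ⟨b / 8 / ((Λ + 1) * (Lg + 1)), by positivity, ?_⟩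
    have : (Λ + 1) * (Lg * (b / 8 / ((Λ + 1) * (Lg + 1)))) = b / 8 * (Lg / (Lg + 1)) := by
      field_simp
    rw [this]
    refine mul_le_of_le_one_right (by positivity) ?_
    rw [div_le_one (by positivity)]; linarith
  obtain ⟨d₁, hd₁, hmod₁⟩ := Metric.uniformContinuousOn_iff_le.1
    (hQ.uniformContinuousOn_of_continuous hv) (θ / 3) (by positivity)
  obtain ⟨d₂, hd₂, hmod₂⟩ := Metric.uniformContinuousOn_iff_le.1
    (hQ.uniformContinuousOn_of_continuous hfQ) e₁ he₁
  obtain ⟨d, hd, hdd₁, hdd₂⟩ : ∃ d > 0, d ≤ d₁ ∧ d ≤ d₂ :=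
    ⟨min d₁ d₂, by positivity, min_le_left _ _, min_le_right _ _⟩
  obtain ⟨R, hR, hRd⟩ : ∃ R : ℝ, 0 ≤ R ∧ S₀ ≤ R * d ^ 2 :=
    ⟨S₀ / d ^ 2, by positivity, by rw [div_mul_cancel₀ _ (by positivity)]⟩
  have hloc := fun z hz h => penalized_localization (n := n) (u := u) (c := c) (ρ := ρ) (ρ₀ := ρ₀) (S₀ := S₀)
    (κ := κ) (N := N) (S := S) (M := M) (R := R) (T' := T') (θ := θ) (d := d) (c₀ := c₀)
    hL.le hM hR hθ hd.le hS₀ (fun w hw w' hw' => by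
      have h1 := abs_le.1 (hB w.fst w.snd (hIcc hw.2))
      have h2 := abs_le.1 (hB w'.fst w'.snd (hIcc hw'.2))
      linarith) hS (fun w hw w' hw' h => hmod₁ w hw w' hw' (h.trans hdd₁)) hinit
    (fun x hx t ht => hconst x hx t (hIcc ht)) hρ hρS hRd (z := z) hz h
  obtain ⟨z₀, hz₀⟩ : ∃ z₀ : SpaceTimePair n,
      z₀ = WithLp.toLp 2 (WithLp.toLp 2 (x₀, t₀), WithLp.toLp 2 (y₀, t₀)) := ⟨_, rfl⟩
  have hz₀mem : z₀ ∈ l2prod (cylinder c ρ T') (cylinder c ρ T') := by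
    rw [hz₀]
    exact ⟨⟨hx₀, ht₀0.le, hT'0.le⟩, ⟨hy₀, ht₀0.le, hT'0.le⟩⟩
  have hlt := penalized_difference_lt hσ hconv hg hg_lip hg_mono hf hf_lip hu hL hMdef hκ hN
    hSpos hR hT'T hθ hd he₁ he₁b (fun w hw w' hw' h => hmod₂ w hw w' hw' (h.trans hdd₂)) hloc hz₀mem
  have h1 := mul_le_mul_of_nonneg_left (sqrt_norm_sq_add_le (x₀ - y₀) hκ.le)
    (show 0 ≤ L * Real.exp (M * t₀) by positivity)
  rw [mul_add, hκγ] at h1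
  simp only [hz₀, penalty, WithLp.toLp_fst, WithLp.toLp_snd, sub_self] at hlt
  linarith

end Main

end

theorem theoremL {n : ℕ} (σ : Eucl n → ℝ) (g : Eucl n → ℝ → ℝ) (f : Eucl n → ℝ → ℝ)
    (u : Eucl n → ℝ → ℝ) (T : ℝ) (hT : 0 < T) (Lg Lf : ℝ≥0)
    (hσ_smooth : ContDiffOn ℝ 2 σ {0}ᶜ) (hσ_convex : ConvexOn ℝ univ σ)
    (hg_cont : ContinuousOn (fun q : Eucl n × ℝ => g q.1 q.2) (sphere 0 1 ×ˢ univ))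
    (hg_lip : ∀ ν ∈ sphere (0 : Eucl n) 1, LipschitzWith Lg (g ν))
    (hg_mono : ∀ ν ∈ sphere (0 : Eucl n) 1, Monotone (g ν))
    (hf_cont : ContinuousOn (fun z : Eucl n × ℝ => f z.1 z.2) (univ ×ˢ Icc (0 : ℝ) T))
    (hf_lip : ∀ t ∈ Icc (0 : ℝ) T, LipschitzWith Lf (fun x => f x t))
    (hu : IsViscSol σ g f T u)
    (hu_const : ∃ (z : Eucl n) (R c : ℝ), ∀ x ∉ ball z R, ∀ t ∈ Icc (0 : ℝ) T, u x t = c)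
    (hu_init : ∃ K : ℝ≥0, LipschitzWith K (fun x => u x 0)) :
    ∀ x y : Eucl n, ∀ t ∈ Icc (0 : ℝ) T,
      |u x t - u y t|
        ≤ (lipConst (fun x => u x 0) : ℝ) * Real.exp ((Lg : ℝ) * (Lf : ℝ) * t) * ‖x - y‖ := by
  obtain ⟨c, ρ₀, c₀, hconst⟩ := hu_const
  have hopen : ∀ L : ℝ, (lipConst (fun x => u x 0) : ℝ) < L → ∀ x y : Eucl n, ∀ t ∈ Ioo (0 : ℝ) T,
      u x t - u y t ≤ L * Real.exp ((Lg : ℝ) * (Lf : ℝ) * t) * ‖x - y‖ := by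
    intro L hL x y t ht
    have hL0 : 0 < L := (NNReal.coe_nonneg _).trans_lt hL
    obtain ⟨K, hK, hKL⟩ := exists_lt_of_csInf_lt (s := {K : ℝ≥0 | LipschitzWith K fun x => u x 0})
      hu_init (b := L.toNNReal) (by rwa [Real.lt_toNNReal_iff_coe_lt])
    have hKL' : (K : ℝ) < L := by rwa [Real.lt_toNNReal_iff_coe_lt] at hKL
    refine sub_le_mul_exp_mul_norm_sub hσ_smooth hσ_convex hg_cont hg_lip hg_mono hf_cont hf_lip hu
      hconst hL0 (fun x y => ?_) x y ht
    have hK : LipschitzWith K fun x => u x 0 := hK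
    have h1 := hK.dist_le_mul x y
    rw [Real.dist_eq, dist_eq_norm] at h1
    calc u x 0 - u y 0 ≤ K * ‖x - y‖ := (le_abs_self _).trans h1
      _ ≤ L * ‖x - y‖ := by gcongr
  have hopen' : ∀ x y : Eucl n, ∀ t ∈ Ioo (0 : ℝ) T, u x t - u y t
      ≤ (lipConst (fun x => u x 0) : ℝ) * Real.exp ((Lg : ℝ) * (Lf : ℝ) * t) * ‖x - y‖ := by
    intro x y t ht
    have hlim : Tendsto (fun L : ℝ => L * Real.exp ((Lg : ℝ) * (Lf : ℝ) * t) * ‖x - y‖)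
        (𝓝[>] (lipConst (fun x => u x 0) : ℝ))
        (𝓝 ((lipConst (fun x => u x 0) : ℝ) * Real.exp ((Lg : ℝ) * (Lf : ℝ) * t) * ‖x - y‖)) := by
      have : Continuous fun L : ℝ => L * Real.exp ((Lg : ℝ) * (Lf : ℝ) * t) * ‖x - y‖ := by fun_prop
      exact (this.tendsto _).mono_left nhdsWithin_le_nhds
    refine ge_of_tendsto hlim ?_
    filter_upwards [self_mem_nhdsWithin] with L hL using hopen L hL x y t ht
  have hclosed : ∀ x y : Eucl n, ∀ t ∈ Icc (0 : ℝ) T, u x t - u y t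
      ≤ (lipConst (fun x => u x 0) : ℝ) * Real.exp ((Lg : ℝ) * (Lf : ℝ) * t) * ‖x - y‖ := by
    intro x y t ht
    have hcont : ∀ x : Eucl n, ContinuousOn (fun t => u x t) (Icc 0 T) := fun x =>
      hu.cont.comp (f := fun t : ℝ => (x, t)) (by fun_prop) fun t ht => ⟨mem_univ _, ht⟩
    rw [← closure_Ioo hT.ne] at ht
    refine le_on_closure (s := Ioo (0 : ℝ) T) (hopen' x y) ?_ ?_ ht
    · rw [closure_Ioo hT.ne]
      exact (hcont x).sub (hcont y)
    · exact Continuous.continuousOn (by fun_prop)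
  intro x y t ht
  rw [abs_le]
  have h1 := hclosed x y t ht
  have h2 := hclosed y x t ht
  rw [norm_sub_rev] at h2
  constructor <;> linarith
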